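/- Let $n\ge 1$, let $\nu$ be a probability measure on $\mathbb R^d\times\mathbb R$ carried by $\mathcal X\times\mathcal Y$, let $(X,Y)\sim\nu$, and let $\mathcal D=(x^{(i)},y^{(i)})_{1\le i\le n}$ be i.i.d. copies of $(X,Y)$. For $k\in\mathbb N$ let $h_k=He_k/\sqrt{k!}$ be the normalised (probabilists') Hermite polynomial, and for a multi-index $\alpha\in\mathbb N^d$, with $|\alpha|=\sum_a\alpha_a$, let $H_\alpha(x)=\prod_{a=1}^d h_{\alpha_a}(x_a)$. Write $(\mathbb N^d)^*=\mathbb N^d\setminus\{0\}$ and let $(e_a)_a$ be the canonical basis. Let $(c_k)_{k>0}$ be a sequence of non-negative reals. Let $\mathcal F$ be the space of functions $f=\sum_{\alpha\in\mathbb N^d}\hat f(\alpha)H_\alpha$ spanned by $H_0$ and the $H_\alpha$, $\alpha\in(\mathbb N^d)^*$, with $c_{|\alpha|}>0$; the result holds both when $\mathcal F$ is the set of finite linear combinations, and when $\mathcal F$ is the set of all expansions in these $H_\alpha$ that converge unconditionally at every point of $\mathbb R^d$ and satisfy $\sum_{\alpha\ne0}\frac{|\alpha|}{c_{|\alpha|}}\hat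 f(\alpha)^2<\infty$ (sums over the $\alpha$ with $c_{|\alpha|}>0$). For $f\in\mathcal F$ let $\Omega(f)=\Omega_{\rm var}(f)+|\hat f(0)|$ or $\Omega(f)=\Omega_{\rm feat}(f)+|\hat f(0)|$ (the result holds for either choice), where $$\Omega_{\rm var}(f)=\sum_{a=1}^d\Big(\sum_{\alpha\in(\mathbb N^d)^*}\frac{\alpha_a}{c_{|\alpha|}}\hat f(\alpha)^2\Big)^{1/2},\qquad \Omega_{\rm feat}(f)=\operatorname{tr}\big(M_f^{1/2}\big),$$ $$(M_f)_{a,b}=\sum_{\alpha\in\mathbb N^d}\frac{1}{c_{|\alpha|+1}}\sqrt{\alpha_a+1}\,\sqrt{\alpha_b+1}\;\hat f(\alpha+e_a)\hat f(\alpha+e_b)$$ (terms with $c_{|\alpha|}=0$, respectively $c_{|\alpha|+1}=0$, where the coefficients vanish, count as $0$). Let $\ell:\mathbb R\times\mathbb R\to\mathbb R$ be a measurable loss, $\mathcal R(f)=\mathbb E\,\ell(Y,f(X))$ and $\widehat{\mathcal R}(f)=\frac1n\sum_{i=1}^n\ell(y^{(i)},f(x^{(i)}))$. Assume that $f^*\in\operatorname{argmin}_{f\in\mathcal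 F}\mathcal R(f)$ exists and let $D\ge\Omega(f^*)$. Assume that, for some $G\ge0$ and every $y\in\mathcal Y$, the function $\ell(y,\cdot)$ is $G$-Lipschitz on the set of values $\{f(x):x\in\mathcal X,\ f\in\mathcal F,\ \Omega(f)\le D\}$, and that $$\ell_\infty:=\sup\{|\ell(y,f(x))|:\ (x,y)\in\mathcal X\times\mathcal Y,\ f\in\mathcal F,\ \Omega(f)\le D\}$$ is finite. Then for every $\delta\in(0,1)$, with probability at least $1-\delta$ over $\mathcal D$, every $f^D\in\operatorname{argmin}_{f\in\mathcal F,\ \Omega(f)\le D}\widehat{\mathcal R}(f)$ satisfies $$\mathcal R(f^D)\le\mathcal R(f^*)+\frac{4GD}{\sqrt n}\sqrt{\frac\pi2}\sqrt{1+\sum_{\alpha\in(\mathbb N^d)^*}\frac{c_{|\alpha|}}{|\alpha|}\,\mathbb E\big(H_\alpha(X)^2\big)}+\frac{\ell_\infty\,2\sqrt2}{\sqrt n}\sqrt{\log\frac1\delta},$$ where the sum may be $+\infty$ and $0\cdot\infty=0$. -/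

import Mathlib

open MeasureTheory ProbabilityTheory
open scoped ENNReal

noncomputable section

namespace HermiteERM

/-- The length `|α| = α₁ + ⋯ + α_d` of a multi-index `α ∈ ℕ^d`. -/
def deg {d : ℕ} (α : Fin d → ℕ) : ℕ := ∑ a, α a

/-- The normalised one-dimensional Hermite polynomial `h_k = He_k / √(k!)`, where `He_k` is the
probabilists' Hermite polynomial. -/
def hermiteOne (k : ℕ) (t : ℝ) : ℝ :=
  Polynomial.aeval t (Polynomial.hermite k) / √(k.factorial : ℝ)

/-- The multivariate Hermite polynomial `H_α(x) = ∏ₐ h_{αₐ}(xₐ)`. -/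
def hermiteMulti {d : ℕ} (α : Fin d → ℕ) (x : EuclideanSpace ℝ (Fin d)) : ℝ :=
  ∏ a, hermiteOne (α a) (x a)

/-- A function `f = ∑_α f̂(α) H_α` is represented by its family of Hermite coefficients `f̂`. -/
abbrev Coeff (d : ℕ) : Type := (Fin d → ℕ) → ℝ

/-- The value at `x` of the function `f = ∑_α f̂(α) H_α`. -/
def eval {d : ℕ} (f : Coeff d) (x : EuclideanSpace ℝ (Fin d)) : ℝ :=
  ∑' α, f α * hermiteMulti α x

/-- The finite linear span of `H_0` and of the `H_α`, `α ≠ 0`, with `c_{|α|} > 0`. -/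
def hermiteSpan {d : ℕ} (c : ℕ → ℝ) : Set (Coeff d) :=
  {f | (Function.support f).Finite ∧ ∀ α, α ≠ 0 → ¬ 0 < c (deg α) → f α = 0}

/-- The space of the possibly infinite expansions `f = ∑_α f̂(α) H_α` in `H_0` and the `H_α`,
`α ≠ 0`, with `c_{|α|} > 0`, that converge (unconditionally) at every point of `ℝ^d` and for which
`∑_{α ≠ 0} (|α| / c_{|α|}) f̂(α)²` is finite; that is, all the series `∑_α (αₐ / c_{|α|}) f̂(α)²` in
the penalties are finite. -/
def hermiteSpace {d : ℕ} (c : ℕ → ℝ) : Set (Coeff d) :=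
  {f | (∀ α, α ≠ 0 → ¬ 0 < c (deg α) → f α = 0) ∧
    Summable (fun α : {α : Fin d → ℕ // α ≠ 0} =>
      (deg α.1 : ℝ) / c (deg α.1) * f α.1 ^ 2) ∧
    ∀ x : EuclideanSpace ℝ (Fin d), Summable (fun α => f α * hermiteMulti α x)}

/-- The variable selection penalty (exponent `r = 1`),
`Ω_var(f) = ∑ₐ (∑_{α ≠ 0} (αₐ / c_{|α|}) f̂(α)²)^{1/2}`.
On the function spaces above `f̂(α) = 0` whenever `α ≠ 0` and `c_{|α|} = 0`. -/
def omegaVar {d : ℕ} (c : ℕ → ℝ) (f : Coeff d) : ℝ :=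
  ∑ a : Fin d, √(∑' α : {α : Fin d → ℕ // α ≠ 0},
    (α.1 a : ℝ) / c (deg α.1) * f α.1 ^ 2)

/-- The matrix
`(M_f)_{a,b} = ∑_α (1 / c_{|α|+1}) √(αₐ + 1) √(α_b + 1) f̂(α + eₐ) f̂(α + e_b)`. -/
def featMatrix {d : ℕ} (c : ℕ → ℝ) (f : Coeff d) : Matrix (Fin d) (Fin d) ℝ :=
  Matrix.of fun a b => ∑' α : Fin d → ℕ,
    1 / c (deg α + 1) * √((α a : ℝ) + 1) * √((α b : ℝ) + 1) *
      f (α + Pi.single a 1) * f (α + Pi.single b 1)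

/-- The feature learning penalty (exponent `r = 1`), `Ω_feat(f) = tr(M_f^{1/2})`, with the square
root of the symmetric matrix `M_f` given by the functional calculus. -/
def omegaFeat {d : ℕ} (c : ℕ → ℝ) (f : Coeff d) : ℝ :=
  (cfc Real.sqrt (featMatrix c f)).trace

/-- `Ω(f) = Ω_var(f) + |f̂(0)|`. -/
def normVar {d : ℕ} (c : ℕ → ℝ) (f : Coeff d) : ℝ := omegaVar c f + |f 0|

/-- `Ω(f) = Ω_feat(f) + |f̂(0)|`. -/
def normFeat {d : ℕ} (c : ℕ → ℝ) (f : Coeff d) : ℝ := omegaFeat c f + |f 0|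

/-- The expected risk `R(f) = E ℓ(Y, f(X))`, where `ν` is the law of `(X, Y)`. -/
def risk {d : ℕ} (ℓ : ℝ → ℝ → ℝ) (ν : Measure (EuclideanSpace ℝ (Fin d) × ℝ))
    (f : Coeff d) : ℝ :=
  ∫ z, ℓ z.2 (eval f z.1) ∂ν

/-- The empirical risk `(1/n) ∑ᵢ ℓ(yᵢ, f(xᵢ))` of a data set `z = (xᵢ, yᵢ)ᵢ`. -/
def empRisk {d n : ℕ} (ℓ : ℝ → ℝ → ℝ) (z : Fin n → EuclideanSpace ℝ (Fin d) × ℝ)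
    (f : Coeff d) : ℝ :=
  1 / (n : ℝ) * ∑ i, ℓ (z i).2 (eval f (z i).1)

/-- `f` minimises the expected risk over `F` (among the functions whose expected risk is a
convergent integral). -/
def IsRiskMinimiser {d : ℕ} (ℓ : ℝ → ℝ → ℝ) (ν : Measure (EuclideanSpace ℝ (Fin d) × ℝ))
    (F : Set (Coeff d)) (f : Coeff d) : Prop :=
  f ∈ F ∧ Integrable (fun z => ℓ z.2 (eval f z.1)) ν ∧
    ∀ g ∈ F, Integrable (fun z => ℓ z.2 (eval g z.1)) ν → risk ℓ ν f ≤ risk ℓ ν g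

/-- `f` minimises the empirical risk of the data set `z` over `{g ∈ F | Ω(g) ≤ D}`. -/
def IsConstrainedERM {d n : ℕ} (ℓ : ℝ → ℝ → ℝ) (z : Fin n → EuclideanSpace ℝ (Fin d) × ℝ)
    (F : Set (Coeff d)) (Om : Coeff d → ℝ) (D : ℝ) (f : Coeff d) : Prop :=
  f ∈ F ∧ Om f ≤ D ∧ ∀ g ∈ F, Om g ≤ D → empRisk ℓ z f ≤ empRisk ℓ z g

/-- The values `|ℓ(y, f(x))|` for `x ∈ 𝒳`, `y ∈ 𝒴` and `f ∈ F` with `Ω(f) ≤ D`. -/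
def lossValues {d : ℕ} (ℓ : ℝ → ℝ → ℝ) (𝒳 : Set (EuclideanSpace ℝ (Fin d))) (𝒴 : Set ℝ)
    (F : Set (Coeff d)) (Om : Coeff d → ℝ) (D : ℝ) : Set ℝ :=
  {t | ∃ x ∈ 𝒳, ∃ y ∈ 𝒴, ∃ f ∈ F, Om f ≤ D ∧ t = |ℓ y (eval f x)|}

/-- `∑_{α ≠ 0} (c_{|α|} / |α|) E[H_α(X)²]`, a sum of nonnegative terms with values in `[0, ∞]`. -/
def hermiteMoment {d : ℕ} (c : ℕ → ℝ) (ν : Measure (EuclideanSpace ℝ (Fin d) × ℝ)) : ℝ≥0∞ :=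
  ∑' α : {α : Fin d → ℕ // α ≠ 0},
    ENNReal.ofReal (c (deg α.1) / (deg α.1 : ℝ)) *
      ∫⁻ z, ENNReal.ofReal (hermiteMulti α.1 z.1 ^ 2) ∂ν

end HermiteERM

end

open HermiteERM

/-! Evaluation is linear in the coefficients. Multiplying `f̂(α)` by `√(|α|/c_{|α|})` and `H_α(x)`
by the inverse weight gives `f(x) = ⟨θ_f, Ψ(x)⟩` in `ℓ²` (`inner_coeffVec_featVec`). Both penalties
dominate the norm of `θ_f` (`norm_coeffVec_le`), because a root of a sum is at most the sum of the
roots: of the directional energies for `Ω_var`, of the eigenvalues of `M_f` for `Ω_feat`. So the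
constraint set lies in a Hilbert ball of radius `D`, while `E‖Ψ(X)‖²` is one plus the Hermite moment
(`lintegral_featKernel`).

The rest is uniform deviation over a ball of linear functionals. Symmetrization costs a factor 2,
contraction replaces the loss by `G` times the functional, and orthogonality of the signs gives mean
deviation at most `2GD √(E‖Ψ‖²)/√n`, below the stated constant since `√(π/2) ≥ 1`. McDiarmid's
inequality supplies the confidence term. It is applied once, to the supremum of deviations relative
to `f*`; since the empirical minimiser has no larger empirical risk than `f*`, this relative
deviation bounds its excess risk.

Suprema are taken over countable families to keep them measurable, and separability of `ℓ²` extends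
the result to the whole ball. An infinite moment makes the bound trivial unless `GD = 0`, in which
case all risks on the ball agree. -/

/-! ### McDiarmid's inequality -/

theorem integral_pi_fin_succ {E : Type*} [MeasurableSpace E] (ν : Measure E)
    [IsProbabilityMeasure ν] {n : ℕ} (f : (Fin (n + 1) → E) → ℝ) :
    ∫ x, f x ∂(Measure.pi fun _ : Fin (n + 1) => ν) =
      ∫ p, f (Fin.cons p.1 p.2) ∂(ν.prod (Measure.pi fun _ : Fin n => ν)) := by
  rw [← ((measurePreserving_piFinSuccAbove (fun _ : Fin (n + 1) => ν) 0).symm).integral_comp']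
  simp [MeasurableEquiv.piFinSuccAbove_symm_apply, Fin.insertNthEquiv]

theorem measurable_fin_cons {E : Type*} [MeasurableSpace E] {n : ℕ} :
    Measurable fun p : E × (Fin n → E) => (Fin.cons p.1 p.2 : Fin (n + 1) → E) := by
  rw [measurable_pi_iff]
  intro i
  refine Fin.cases ?_ (fun j => ?_) i
  · simpa using measurable_fst
  · simp only [Fin.cons_succ]; fun_prop

/-- Hoeffding's lemma for a function whose values differ by at most `c`. -/
theorem integral_exp_sub_le_of_abs_sub_le {E : Type*} [MeasurableSpace E] (ν : Measure E)
    [IsProbabilityMeasure ν] {f : E → ℝ} (hf : Measurable f) {c : ℝ}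
    (hdiff : ∀ x y, |f x - f y| ≤ c) (t : ℝ) :
    ∫ x, Real.exp (t * (f x - ∫ y, f y ∂ν)) ∂ν ≤ Real.exp (c ^ 2 / 4 * t ^ 2 / 2) := by
  obtain ⟨x₀⟩ : Nonempty E := ν.nonempty_of_neZero
  have hc : 0 ≤ c := (abs_nonneg _).trans (hdiff x₀ x₀)
  have : Nonempty E := ⟨x₀⟩
  have hbb : BddBelow (Set.range f) := ⟨f x₀ - c, by
    rintro _ ⟨y, rfl⟩; linarith [abs_le.1 (hdiff x₀ y)]⟩
  -- Oscillation at most `c` puts `f` in an interval of length `c`, whence the variance proxy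
  -- `(c/2)²`.
  have hmem : ∀ x, f x ∈ Set.Icc (⨅ y, f y) ((⨅ y, f y) + c) := fun x =>
    ⟨ciInf_le hbb x, by
      rw [← sub_le_iff_le_add]
      exact le_ciInf fun y => by linarith [abs_le.1 (hdiff x y)]⟩
  have h := (hasSubgaussianMGF_of_mem_Icc (μ := ν) hf.aemeasurable (.of_forall hmem)).mgf_le t
  refine h.trans (le_of_eq ?_)
  congr 3
  simp only [add_sub_cancel_left, NNReal.coe_pow, NNReal.coe_div, coe_nnnorm, Real.norm_eq_abs,
    abs_of_nonneg hc, NNReal.coe_ofNat]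
  ring

/-- The exponential moment bound behind McDiarmid's inequality. -/
theorem integral_exp_le_of_bounded_differences {E : Type*} [MeasurableSpace E] (ν : Measure E)
    [IsProbabilityMeasure ν] {c M : ℝ} (t : ℝ) {n : ℕ} (f : (Fin n → E) → ℝ)
    (hf : Measurable f) (hbd : ∀ x, |f x| ≤ M)
    (hdiff : ∀ x i y, |f x - f (Function.update x i y)| ≤ c) :
    ∫ x, Real.exp (t * (f x - ∫ y, f y ∂(Measure.pi fun _ : Fin n => ν)))
      ∂(Measure.pi fun _ : Fin n => ν) ≤ Real.exp (n * (c ^ 2 / 4) * t ^ 2 / 2) := by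
  induction n with
  | zero =>
    have h : ∀ x, f x = f default := fun x => by rw [Subsingleton.elim x default]
    have : (∫ y, f y ∂(Measure.pi fun _ : Fin 0 => ν)) = f default := by
      simp_rw [h]; simp
    simp [h]
  | succ n ih =>
    set μ := Measure.pi fun _ : Fin n => ν with hμ
    set F : E × (Fin n → E) → ℝ := fun p => f (Fin.cons p.1 p.2) with hF
    have hFm : Measurable F := hf.comp measurable_fin_cons
    have hFb : ∀ p, |F p| ≤ M := fun p => hbd _
    have hFint : Integrable F (ν.prod μ) :=
      .of_bound hFm.aestronglyMeasurable M (.of_forall hFb)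
    -- Averaging out the first coordinate keeps the mean, the bound and the bounded differences, so
    -- the induction hypothesis applies to `g`.
    set g : (Fin n → E) → ℝ := fun xs => ∫ x, F (x, xs) ∂ν with hg
    have hgm : Measurable g :=
      (StronglyMeasurable.integral_prod_left' hFm.stronglyMeasurable).measurable
    have hint : ∀ xs, Integrable (fun x => F (x, xs)) ν := fun xs =>
      .of_bound (hFm.comp (by fun_prop)).aestronglyMeasurable M (.of_forall fun x => hFb _)
    have hgb : ∀ xs, |g xs| ≤ M := fun xs => by
      simpa using norm_integral_le_of_norm_le_const (μ := ν) (f := fun x => F (x, xs))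
        (.of_forall fun x => hFb _)
    have hgd : ∀ xs i y, |g xs - g (Function.update xs i y)| ≤ c := fun xs i y => by
      rw [hg, ← integral_sub (hint _) (hint _)]
      have := norm_integral_le_of_norm_le_const (μ := ν)
        (f := fun x => F (x, xs) - F (x, Function.update xs i y)) (C := c)
        (.of_forall fun x => by
          simp only [hF, Fin.cons_update]
          exact hdiff _ _ _)
      simpa using this
    have hmean : ∫ x, f x ∂(Measure.pi fun _ : Fin (n + 1) => ν) = ∫ xs, g xs ∂μ := by
      rw [integral_pi_fin_succ, integral_prod_symm _ hFint]
    rw [hmean, integral_pi_fin_succ]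
    set m := ∫ xs, g xs ∂μ
    have hm : |m| ≤ M := by
      simpa using norm_integral_le_of_norm_le_const (μ := μ) (f := g) (.of_forall fun x => hgb _)
    have hexp : ∀ a b : ℝ, |a| ≤ M → |b| ≤ M → ‖Real.exp (t * (a - b))‖ ≤
        Real.exp (|t| * (M + M)) := fun a b ha hb => by
      rw [Real.norm_eq_abs, Real.abs_exp]
      refine Real.exp_le_exp.2 ((le_abs_self _).trans ?_)
      rw [abs_mul]
      exact mul_le_mul_of_nonneg_left ((abs_sub _ _).trans (add_le_add ha hb)) (abs_nonneg _)
    have hint2 : Integrable (fun p : E × (Fin n → E) => Real.exp (t * (F p - m))) (ν.prod μ) :=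
      .of_bound (by fun_prop) _ (.of_forall fun p => hexp _ _ (hFb p) hm)
    have hint3 : Integrable (fun xs => Real.exp (t * (g xs - m))) μ :=
      .of_bound (by fun_prop) _ (.of_forall fun p => hexp _ _ (hgb p) hm)
    change ∫ p, Real.exp (t * (F p - m)) ∂(ν.prod μ) ≤ _
    rw [integral_prod_symm _ hint2]
    calc ∫ xs, ∫ x, Real.exp (t * (F (x, xs) - m)) ∂ν ∂μ
        ≤ ∫ xs, Real.exp (c ^ 2 / 4 * t ^ 2 / 2) * Real.exp (t * (g xs - m)) ∂μ := by
          refine integral_mono hint2.integral_prod_right (hint3.const_mul _) fun xs => ?_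
          -- With `xs` fixed, `g xs` is the mean of `F (·, xs)`: Hoeffding's lemma controls the
          -- first factor and the second is constant.
          have h1 : ∀ x, Real.exp (t * (F (x, xs) - m)) =
              Real.exp (t * (F (x, xs) - g xs)) * Real.exp (t * (g xs - m)) := fun x => by
            rw [← Real.exp_add]; ring_nf
          simp only [h1]
          rw [integral_mul_const]
          refine mul_le_mul_of_nonneg_right ?_ (Real.exp_pos _).le
          refine integral_exp_sub_le_of_abs_sub_le ν (hFm.comp (by fun_prop)) (fun x y => ?_) t
          have := hdiff (Fin.cons x xs) 0 y
          rwa [Fin.update_cons_zero] at this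
      _ = Real.exp (c ^ 2 / 4 * t ^ 2 / 2) * ∫ xs, Real.exp (t * (g xs - m)) ∂μ :=
          integral_const_mul _ _
      _ ≤ Real.exp (c ^ 2 / 4 * t ^ 2 / 2) * Real.exp (n * (c ^ 2 / 4) * t ^ 2 / 2) :=
          mul_le_mul_of_nonneg_left (ih g hgm hgb hgd) (Real.exp_pos _).le
      _ = _ := by
          rw [← Real.exp_add]; push_cast; ring_nf

/-- **McDiarmid's inequality** for a bounded function of `n` independent variables. -/
theorem measureReal_le_sub_integral_le_of_bounded_differences {E : Type*} [MeasurableSpace E]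
    (ν : Measure E) [IsProbabilityMeasure ν] {c M s : ℝ} {n : ℕ} (f : (Fin n → E) → ℝ)
    (hf : Measurable f) (hbd : ∀ x, |f x| ≤ M)
    (hdiff : ∀ x i y, |f x - f (Function.update x i y)| ≤ c) (hs : 0 ≤ s) :
    (Measure.pi fun _ : Fin n => ν).real
        {x | s ≤ f x - ∫ y, f y ∂(Measure.pi fun _ : Fin n => ν)} ≤
      Real.exp (-s ^ 2 / (2 * (n * (c ^ 2 / 4)))) := by
  set μ := Measure.pi fun _ : Fin n => ν
  have hsub : HasSubgaussianMGF (fun x => f x - ∫ y, f y ∂μ)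
      ⟨n * (c ^ 2 / 4), by positivity⟩ μ := by
    refine ⟨fun t => ?_, fun t => integral_exp_le_of_bounded_differences ν t f hf hbd hdiff⟩
    refine .of_bound (C := Real.exp (|t| * (M + |∫ y, f y ∂μ|))) (by fun_prop)
      (.of_forall fun x => ?_)
    rw [Real.norm_eq_abs, Real.abs_exp]
    refine Real.exp_le_exp.2 ((le_abs_self _).trans ?_)
    rw [abs_mul]
    exact mul_le_mul_of_nonneg_left ((abs_sub _ _).trans (add_le_add_left (hbd x) _))
      (abs_nonneg _)
  exact hsub.measure_ge_le hs

/-! ### Rademacher averages and contraction -/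

/-- The sign `±1` encoded by a Boolean. -/
def boolSign (b : Bool) : ℝ := cond b 1 (-1)

@[simp] theorem boolSign_true : boolSign true = 1 := rfl

@[simp] theorem boolSign_false : boolSign false = -1 := rfl

@[simp] theorem boolSign_not (b : Bool) : boolSign (!b) = -boolSign b := by cases b <;> simp

@[simp] theorem abs_boolSign (b : Bool) : |boolSign b| = 1 := by cases b <;> simp

theorem sum_fin_succ_bool {n : ℕ} (F : (Fin (n + 1) → Bool) → ℝ) :
    ∑ ε, F ε = ∑ ε : Fin n → Bool, (F (Fin.cons true ε) + F (Fin.cons false ε)) := by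
  rw [← (Fin.consEquiv fun _ : Fin (n + 1) => Bool).sum_comp F, Fintype.sum_prod_type_right]
  simp [Fin.consEquiv]

theorem abs_sum_boolSign_mul_le {n : ℕ} {T : ℝ} {t : Fin n → ℝ} (ht : ∀ i, |t i| ≤ T)
    (ε : Fin n → Bool) : |∑ i, boolSign (ε i) * t i| ≤ n * T := by
  refine (Finset.abs_sum_le_sum_abs _ _).trans ?_
  refine (Finset.sum_le_card_nsmul _ _ T fun i _ => ?_).trans (by simp)
  rw [abs_mul, abs_boolSign, one_mul]
  exact ht i

theorem bddAbove_range_of_abs_le {ι : Type*} {f : ι → ℝ} {M : ℝ} (h : ∀ q, |f q| ≤ M) :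
    BddAbove (Set.range f) :=
  ⟨M, by rintro _ ⟨q, rfl⟩; exact (abs_le.1 (h q)).2⟩

/-- The one-coordinate contraction step for Rademacher averages. -/
theorem iSup_add_add_iSup_sub_le {ι : Type*} [Nonempty ι] {b s t : ι → ℝ} {A T : ℝ}
    (hb : ∀ q, |b q| ≤ A) (ht : ∀ q, |t q| ≤ T) (hst : ∀ p q, |s p - s q| ≤ |t p - t q|) :
    (⨆ q, (b q + s q)) + (⨆ q, (b q - s q)) ≤ (⨆ q, (b q + t q)) + (⨆ q, (b q - t q)) := by
  have h1 : BddAbove (Set.range fun q => b q + t q) := bddAbove_range_of_abs_le (M := A + T)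
    fun q => (abs_add_le _ _).trans (add_le_add (hb q) (ht q))
  have h2 : BddAbove (Set.range fun q => b q - t q) := bddAbove_range_of_abs_le (M := A + T)
    fun q => (abs_sub _ _).trans (add_le_add (hb q) (ht q))
  rw [← le_sub_iff_add_le]
  refine ciSup_le fun p => ?_
  rw [le_sub_comm]
  refine ciSup_le fun q => ?_
  -- The sign of `t p - t q` decides which of `p`, `q` is tested in the supremum with `+t` and which
  -- in the one with `-t`.
  have hs := (le_abs_self _).trans (hst p q)
  rcases abs_cases (t p - t q) with h | h
  · have := le_ciSup h1 p
    have := le_ciSup h2 q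
    linarith
  · have := le_ciSup h1 q
    have := le_ciSup h2 p
    linarith

/-- **Contraction principle** for Rademacher averages. -/
theorem sum_iSup_boolSign_le_of_contraction {ι : Type*} [Nonempty ι] {n : ℕ} {A T : ℝ}
    (b : ι → ℝ) (s t : ι → Fin n → ℝ) (hb : ∀ q, |b q| ≤ A) (hs : ∀ q i, |s q i| ≤ T)
    (ht : ∀ q i, |t q i| ≤ T) (hst : ∀ p q i, |s p i - s q i| ≤ |t p i - t q i|) :
    ∑ ε : Fin n → Bool, ⨆ q, (b q + ∑ i, boolSign (ε i) * s q i) ≤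
      ∑ ε : Fin n → Bool, ⨆ q, (b q + ∑ i, boolSign (ε i) * t q i) := by
  -- The offset `b` must vary: the tail is contracted with `± s q 0` in the offset, then coordinate
  -- `0` with the contracted tail in the offset.
  induction n generalizing A b with
  | zero => simp
  | succ n ih =>
    rw [sum_fin_succ_bool, sum_fin_succ_bool]
    simp only [Fin.sum_univ_succ, Fin.cons_zero, Fin.cons_succ, boolSign_true, boolSign_false,
      one_mul, neg_one_mul, ← add_assoc, ← sub_eq_add_neg]
    calc _ ≤ ∑ ε : Fin n → Bool,
          ((⨆ q, (b q + s q 0 + ∑ i : Fin n, boolSign (ε i) * t q i.succ)) +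
            (⨆ q, (b q - s q 0 + ∑ i : Fin n, boolSign (ε i) * t q i.succ))) := by
          rw [Finset.sum_add_distrib, Finset.sum_add_distrib]
          exact add_le_add
            (ih (A := A + T) (fun q => b q + s q 0) (fun q i => s q i.succ)
              (fun q i => t q i.succ)
              (fun q => (abs_add_le _ _).trans (add_le_add (hb q) (hs q 0)))
              (fun q i => hs q _) (fun q i => ht q _) (fun p q i => hst p q _))
            (ih (A := A + T) (fun q => b q - s q 0) (fun q i => s q i.succ)
              (fun q i => t q i.succ)
              (fun q => (abs_sub _ _).trans (add_le_add (hb q) (hs q 0)))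
              (fun q i => hs q _) (fun q i => ht q _) (fun p q i => hst p q _))
      _ ≤ _ := by
          refine Finset.sum_le_sum fun ε _ => ?_
          have := iSup_add_add_iSup_sub_le (s := fun q => s q 0) (t := fun q => t q 0)
            (b := fun q => b q + ∑ i : Fin n, boolSign (ε i) * t q i.succ) (A := A + n * T)
            (T := T) (fun q => (abs_add_le _ _).trans
              (add_le_add (hb q) (abs_sum_boolSign_mul_le (fun i => ht q _) ε)))
            (fun q => ht q 0) (fun p q => hst p q 0)
          simpa only [add_right_comm, add_sub_right_comm] using this

/-- Rademacher signs are orthonormal: the average of `‖∑ εᵢ vᵢ‖²` is `∑ ‖vᵢ‖²`. -/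
theorem sum_norm_sum_boolSign_smul_sq {V : Type*} [NormedAddCommGroup V] [InnerProductSpace ℝ V]
    {n : ℕ} (v : Fin n → V) :
    ∑ ε : Fin n → Bool, ‖∑ i, boolSign (ε i) • v i‖ ^ 2 = 2 ^ n * ∑ i, ‖v i‖ ^ 2 := by
  induction n with
  | zero => simp
  | succ n ih =>
    rw [sum_fin_succ_bool]
    simp only [Fin.sum_univ_succ, Fin.cons_zero, Fin.cons_succ, boolSign_true, boolSign_false,
      one_smul, neg_smul]
    -- Parallelogram law: summing over the first sign cancels the cross term.
    have h : ∀ w : V, ‖v 0 + w‖ ^ 2 + ‖-v 0 + w‖ ^ 2 = 2 * ‖v 0‖ ^ 2 + 2 * ‖w‖ ^ 2 := fun w => by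
      rw [norm_add_sq_real, norm_add_sq_real, norm_neg, inner_neg_left]; ring
    simp only [h]
    rw [Finset.sum_add_distrib, ← Finset.mul_sum, ← Finset.mul_sum, ih fun i => v i.succ]
    simp
    ring

/-- The average of `‖∑ εᵢ vᵢ‖` over the signs is at most `(∑ ‖vᵢ‖²)^{1/2}`. -/
theorem sum_norm_sum_boolSign_smul_le {V : Type*} [NormedAddCommGroup V] [InnerProductSpace ℝ V]
    {n : ℕ} (v : Fin n → V) :
    ∑ ε : Fin n → Bool, ‖∑ i, boolSign (ε i) • v i‖ ≤ 2 ^ n * √(∑ i, ‖v i‖ ^ 2) := by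
  -- Cauchy–Schwarz over the `2 ^ n` sign patterns.
  have h := sq_sum_le_card_mul_sum_sq (s := (Finset.univ : Finset (Fin n → Bool)))
    (f := fun ε => ‖∑ i, boolSign (ε i) • v i‖)
  rw [sum_norm_sum_boolSign_smul_sq] at h
  have h2 := Real.le_sqrt_of_sq_le h
  refine h2.trans (le_of_eq ?_)
  simp only [Finset.card_univ, Fintype.card_pi, Fintype.card_bool, Finset.prod_const,
    Fintype.card_fin, Nat.cast_pow, Nat.cast_ofNat]
  rw [← mul_assoc, Real.sqrt_mul (by positivity), Real.sqrt_mul_self (by positivity)]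

/-- Rademacher complexity of a Lipschitz image of a ball of linear functionals. -/
theorem sum_iSup_boolSign_le_of_inner {ι V : Type*} [Nonempty ι] [NormedAddCommGroup V]
    [InnerProductSpace ℝ V] {n : ℕ} {B D G : ℝ} (hG : 0 ≤ G) (θ : ι → V) (hθ : ∀ q, ‖θ q‖ ≤ D)
    (v : Fin n → V) (s : ι → Fin n → ℝ) (hs : ∀ q i, |s q i| ≤ B)
    (hst : ∀ p q i, |s p i - s q i| ≤ G * |inner ℝ (θ p) (v i) - inner ℝ (θ q) (v i)|) :
    ∑ ε : Fin n → Bool, ⨆ q, ∑ i, boolSign (ε i) * s q i ≤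
      2 ^ n * (G * D * √(∑ i, ‖v i‖ ^ 2)) := by
  have hD : 0 ≤ D := (norm_nonneg _).trans (hθ (Classical.arbitrary ι))
  have hT : ∀ q i, |G * inner ℝ (θ q) (v i)| ≤ max B (∑ j, G * (D * ‖v j‖)) := fun q i => by
    rw [abs_mul, abs_of_nonneg hG]
    refine le_max_of_le_right (le_trans ?_ (Finset.single_le_sum
      (f := fun j => G * (D * ‖v j‖)) (fun j _ => by positivity) (Finset.mem_univ i)))
    exact mul_le_mul_of_nonneg_left ((abs_real_inner_le_norm _ _).trans
      (mul_le_mul_of_nonneg_right (hθ q) (norm_nonneg _))) hG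
  have h := sum_iSup_boolSign_le_of_contraction (A := 0) (fun _ : ι => (0 : ℝ)) s
    (fun q i => G * inner ℝ (θ q) (v i)) (by simp) (fun q i => le_max_of_le_left (hs q i)) hT
    (fun p q i => by rw [← mul_sub, abs_mul, abs_of_nonneg hG]; exact hst p q i)
  simp only [zero_add] at h
  refine h.trans ?_
  calc _ ≤ ∑ ε : Fin n → Bool, G * D * ‖∑ i, boolSign (ε i) • v i‖ := by
        refine Finset.sum_le_sum fun ε _ => ciSup_le fun q => ?_
        have : ∑ i, boolSign (ε i) * (G * inner ℝ (θ q) (v i)) =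
            G * inner ℝ (θ q) (∑ i, boolSign (ε i) • v i) := by
          rw [inner_sum, Finset.mul_sum]
          refine Finset.sum_congr rfl fun i _ => ?_
          rw [real_inner_smul_right]; ring
        rw [this, mul_assoc]
        exact mul_le_mul_of_nonneg_left ((real_inner_le_norm _ _).trans
          (mul_le_mul_of_nonneg_right (hθ q) (norm_nonneg _))) hG
    _ ≤ _ := by
        rw [← Finset.mul_sum, mul_left_comm]
        exact mul_le_mul_of_nonneg_left (sum_norm_sum_boolSign_smul_le v) (by positivity)

/-! ### Symmetrization -/

theorem MeasureTheory.MeasurePreserving.integral_comp_of_measurable {α β : Type*}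
    [MeasurableSpace α] [MeasurableSpace β] {μ : Measure α} {ν : Measure β} {T : α → β}
    (hT : MeasurePreserving T μ ν) {f : β → ℝ} (hf : Measurable f) :
    ∫ x, f (T x) ∂μ = ∫ y, f y ∂ν := by
  rw [← hT.map_eq, integral_map hT.aemeasurable hf.aestronglyMeasurable]

theorem abs_ciSup_le_of_abs_le {ι : Type*} [Nonempty ι] {f : ι → ℝ} {M : ℝ}
    (h : ∀ q, |f q| ≤ M) : |⨆ q, f q| ≤ M :=
  abs_le.2 ⟨(abs_le.1 (h (Classical.arbitrary ι))).1.trans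
    (le_ciSup (bddAbove_range_of_abs_le h) _), ciSup_le fun q => (abs_le.1 (h q)).2⟩

theorem abs_sum_fin_le {n : ℕ} {T : ℝ} {t : Fin n → ℝ} (ht : ∀ i, |t i| ≤ T) :
    |∑ i, t i| ≤ n * T :=
  (Finset.abs_sum_le_sum_abs _ _).trans
    ((Finset.sum_le_card_nsmul _ _ T fun i _ => ht i).trans (by simp))

theorem abs_integral_le_of_abs_le {E : Type*} [MeasurableSpace E] (ν : Measure E)
    [IsProbabilityMeasure ν] {f : E → ℝ} {M : ℝ} (h : ∀ x, |f x| ≤ M) : |∫ x, f x ∂ν| ≤ M := by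
  simpa using norm_integral_le_of_norm_le_const (μ := ν) (f := f) (.of_forall h)

theorem integrable_of_abs_le {E : Type*} [MeasurableSpace E] (ν : Measure E)
    [IsFiniteMeasure ν] {f : E → ℝ} (hf : Measurable f) {M : ℝ} (h : ∀ x, |f x| ≤ M) :
    Integrable f ν :=
  .of_bound hf.aestronglyMeasurable M (.of_forall h)

/-- Ghost-sample step of the symmetrization argument. -/
theorem integral_iSup_sum_integral_sub_le {E ι : Type*} [MeasurableSpace E] [Countable ι]
    [Nonempty ι] (ν : Measure E) [IsProbabilityMeasure ν] {n : ℕ} {B : ℝ} (g : ι → E → ℝ)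
    (hgm : ∀ q, Measurable (g q)) (hgB : ∀ q z, |g q z| ≤ B) :
    ∫ z, ⨆ q, ∑ i, ((∫ x, g q x ∂ν) - g q (z i)) ∂(Measure.pi fun _ : Fin n => ν) ≤
      ∫ w, ⨆ q, ∑ i, (g q (w i).1 - g q (w i).2)
        ∂(Measure.pi fun _ : Fin n => ν.prod ν) := by
  set μ := Measure.pi fun _ : Fin n => ν
  have hb1 : ∀ q (z : Fin n → E), |∑ i, ((∫ x, g q x ∂ν) - g q (z i))| ≤ n * (B + B) := fun q z =>
    abs_sum_fin_le fun i => (abs_sub _ _).trans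
      (add_le_add (abs_integral_le_of_abs_le ν (hgB q)) (hgB q _))
  have hb2 : ∀ q (p : (Fin n → E) × (Fin n → E)),
      |∑ i, (g q (p.1 i) - g q (p.2 i))| ≤ n * (B + B) := fun q p =>
    abs_sum_fin_le fun i => (abs_sub _ _).trans (add_le_add (hgB q _) (hgB q _))
  set H : (Fin n → E) × (Fin n → E) → ℝ := fun p => ⨆ q, ∑ i, (g q (p.1 i) - g q (p.2 i)) with hH
  have hHm : Measurable H := .iSup fun q => by fun_prop
  have hHint : Integrable H (μ.prod μ) :=
    integrable_of_abs_le _ hHm fun p => abs_ciSup_le_of_abs_le fun q => hb2 q p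
  have h1 : ∫ w, ⨆ q, ∑ i, (g q (w i).1 - g q (w i).2) ∂(Measure.pi fun _ : Fin n => ν.prod ν) =
      ∫ p, H p ∂(μ.prod μ) :=
    (measurePreserving_arrowProdEquivProdArrow E E (Fin n) (fun _ => ν) fun _ => ν).integral_comp' H
  rw [h1, integral_prod_symm _ hHint]
  refine integral_mono (integrable_of_abs_le _ (.iSup fun q => by fun_prop)
    fun z => abs_ciSup_le_of_abs_le fun q => hb1 q z) hHint.integral_prod_right fun z => ?_
  refine ciSup_le fun q => ?_
  -- The mean is an average over an independent ghost sample; a supremum of integrals is at most the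
  -- integral of the supremum.
  have h2 : ∑ i, ((∫ x, g q x ∂ν) - g q (z i)) =
      ∫ z', ∑ i, (g q (z' i) - g q (z i)) ∂μ := by
    rw [integral_finsetSum _ fun i _ => integrable_of_abs_le _ (by fun_prop)
      fun z' => (abs_sub _ _).trans (add_le_add (hgB q _) (hgB q _))]
    refine Finset.sum_congr rfl fun i _ => ?_
    rw [integral_sub (integrable_of_abs_le _ (by fun_prop) fun z' => hgB q _)
      (integrable_const _), integral_const]
    rw [(measurePreserving_eval (fun _ : Fin n => ν) i).integral_comp_of_measurable (hgm q)]
    simp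
  rw [h2]
  refine integral_mono (integrable_of_abs_le _ (by fun_prop) fun z' => hb2 q (z', z))
    (integrable_of_abs_le _ (hHm.comp (by fun_prop))
      fun z' => abs_ciSup_le_of_abs_le fun q => hb2 q (z', z)) fun z' => ?_
  exact le_ciSup (f := fun q => ∑ i, (g q (z' i) - g q (z i)))
    (bddAbove_range_of_abs_le fun q => hb2 q (z', z)) q

/-- **Symmetrization**: the expected uniform deviation is at most twice the Rademacher average. -/
theorem two_pow_mul_integral_iSup_le {E ι : Type*} [MeasurableSpace E] [Countable ι]
    [Nonempty ι] (ν : Measure E) [IsProbabilityMeasure ν] {n : ℕ} {B : ℝ} (g : ι → E → ℝ)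
    (hgm : ∀ q, Measurable (g q)) (hgB : ∀ q z, |g q z| ≤ B) :
    2 ^ n * ∫ z, ⨆ q, ∑ i, ((∫ x, g q x ∂ν) - g q (z i)) ∂(Measure.pi fun _ : Fin n => ν) ≤
      2 * ∫ z, ∑ ε : Fin n → Bool, ⨆ q, ∑ i, boolSign (ε i) * g q (z i)
        ∂(Measure.pi fun _ : Fin n => ν) := by
  set μ := Measure.pi fun _ : Fin n => ν
  set μ₂ := Measure.pi fun _ : Fin n => ν.prod ν
  set R : (Fin n → Bool) → (Fin n → E) → ℝ :=
    fun ε z => ⨆ q, ∑ i, boolSign (ε i) * g q (z i) with hR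
  set W : (Fin n → Bool) → (Fin n → E × E) → ℝ :=
    fun ε w => ⨆ q, ∑ i, boolSign (ε i) * (g q (w i).1 - g q (w i).2) with hW
  have hRb : ∀ (ε : Fin n → Bool) q (z : Fin n → E), |∑ i, boolSign (ε i) * g q (z i)| ≤ n * B :=
    fun ε q z => abs_sum_boolSign_mul_le (fun i => hgB q _) ε
  have hWb : ∀ (ε : Fin n → Bool) q (w : Fin n → E × E),
      |∑ i, boolSign (ε i) * (g q (w i).1 - g q (w i).2)| ≤ n * (B + B) := fun ε q w =>
    abs_sum_boolSign_mul_le (fun i => (abs_sub _ _).trans (add_le_add (hgB q _) (hgB q _))) ε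
  have hRm : ∀ ε, Measurable (R ε) := fun ε => .iSup fun q => by fun_prop
  have hWm : ∀ ε, Measurable (W ε) := fun ε => .iSup fun q => by fun_prop
  have hRi : ∀ ε, Integrable (R ε) μ := fun ε =>
    integrable_of_abs_le _ (hRm ε) fun z => abs_ciSup_le_of_abs_le fun q => hRb ε q z
  have hWi : ∀ ε, Integrable (W ε) μ₂ := fun ε =>
    integrable_of_abs_le _ (hWm ε) fun z => abs_ciSup_le_of_abs_le fun q => hWb ε q z
  -- Exchanging the two points of the pairs with sign `-1` preserves the law and flips exactly those
  -- differences.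
  have hswap : ∀ ε, ∫ w, ⨆ q, ∑ i, (g q (w i).1 - g q (w i).2) ∂μ₂ = ∫ w, W ε w ∂μ₂ := fun ε => by
    have hT : MeasurePreserving
        (fun (w : Fin n → E × E) i => (cond (ε i) id Prod.swap : E × E → E × E) (w i)) μ₂ μ₂ :=
      measurePreserving_pi _ _ fun i => by
        cases ε i
        · exact Measure.measurePreserving_swap
        · exact MeasurePreserving.id _
    rw [← hT.integral_comp_of_measurable (hWm ε)]
    refine integral_congr_ae (.of_forall fun w => ?_)
    simp only [hW]
    congr 1
    ext q
    refine Finset.sum_congr rfl fun i _ => ?_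
    cases ε i <;> simp
  have hfst : MeasurePreserving (fun (w : Fin n → E × E) i => (w i).1) μ₂ μ :=
    measurePreserving_pi _ _ fun _ => measurePreserving_fst
  have hsnd : MeasurePreserving (fun (w : Fin n → E × E) i => (w i).2) μ₂ μ :=
    measurePreserving_pi _ _ fun _ => measurePreserving_snd
  have hle : ∀ ε w, W ε w ≤ R ε (fun i => (w i).1) + R (fun i => !ε i) fun i => (w i).2 := by
    intro ε w
    refine ciSup_le fun q => ?_
    have h1 := le_ciSup (f := fun q => ∑ i, boolSign (ε i) * g q (w i).1)
      (bddAbove_range_of_abs_le fun q => hRb ε q fun i => (w i).1) q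
    have h2 := le_ciSup (f := fun q => ∑ i, boolSign (!ε i) * g q (w i).2)
      (bddAbove_range_of_abs_le fun q => hRb (fun i => !ε i) q fun i => (w i).2) q
    refine le_trans (le_of_eq ?_) (add_le_add h1 h2)
    rw [← Finset.sum_add_distrib]
    refine Finset.sum_congr rfl fun i _ => ?_
    rw [boolSign_not]; ring
  have hRf : ∀ ε, Integrable (fun w : Fin n → E × E => R ε fun i => (w i).1) μ₂ := fun ε =>
    hfst.integrable_comp_of_integrable (hRi ε)
  have hRs : ∀ ε, Integrable (fun w : Fin n → E × E => R ε fun i => (w i).2) μ₂ := fun ε =>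
    hsnd.integrable_comp_of_integrable (hRi ε)
  -- Flipping all signs permutes the patterns, so both halves of `hle` contribute equally: this is
  -- the factor 2.
  have hnot : ∑ ε : Fin n → Bool, ∫ z, R (fun i => !ε i) z ∂μ = ∑ ε, ∫ z, R ε z ∂μ :=
    (Equiv.piCongrRight fun _ : Fin n => Equiv.boolNot).sum_comp fun ε => ∫ z, R ε z ∂μ
  calc _ ≤ 2 ^ n * ∫ w, ⨆ q, ∑ i, (g q (w i).1 - g q (w i).2) ∂μ₂ :=
        mul_le_mul_of_nonneg_left (integral_iSup_sum_integral_sub_le ν g hgm hgB) (by positivity)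
    _ = ∑ ε : Fin n → Bool, ∫ w, W ε w ∂μ₂ := by
        rw [Finset.sum_congr rfl fun ε _ => (hswap ε).symm]
        simp
    _ ≤ ∑ ε : Fin n → Bool, (∫ z, R ε z ∂μ + ∫ z, R (fun i => !ε i) z ∂μ) := by
        refine Finset.sum_le_sum fun ε _ => ?_
        rw [← hfst.integral_comp_of_measurable (hRm ε), ← hsnd.integral_comp_of_measurable (hRm _),
          ← integral_add (hRf ε) (hRs _)]
        exact integral_mono (hWi ε) ((hRf ε).add (hRs _)) (hle ε)
    _ = 2 * ∑ ε : Fin n → Bool, ∫ z, R ε z ∂μ := by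
        rw [Finset.sum_add_distrib, hnot, two_mul]
    _ = _ := by rw [integral_finsetSum _ fun ε _ => hRi ε]

/-- Jensen for the concave square root; `√t ≤ t + 1` gives integrability. -/
theorem integral_sqrt_le_sqrt_integral {E : Type*} [MeasurableSpace E] (μ : Measure E)
    [IsProbabilityMeasure μ] {f : E → ℝ} (hf : Integrable f μ) (h0 : ∀ x, 0 ≤ f x) :
    Integrable (fun x => √(f x)) μ ∧ ∫ x, √(f x) ∂μ ≤ √(∫ x, f x ∂μ) := by
  have hi : Integrable (fun x => √(f x)) μ := by
    refine (hf.add (integrable_const 1)).mono'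
      (Real.continuous_sqrt.comp_aestronglyMeasurable hf.1) (.of_forall fun x => ?_)
    rw [Real.norm_eq_abs, abs_of_nonneg (Real.sqrt_nonneg _)]
    simp only [Pi.add_apply]
    nlinarith [Real.sq_sqrt (h0 x), sq_nonneg (√(f x) - 1), Real.sqrt_nonneg (f x)]
  exact ⟨hi, Real.strictConcaveOn_sqrt.concaveOn.le_map_integral Real.continuous_sqrt.continuousOn
    isClosed_Ici (.of_forall h0) hf hi⟩

/-! ### Uniform deviation over countable families -/

/-- The expected uniform deviation of a Lipschitz image of a ball of linear functionals. -/
theorem integral_iSup_deviation_le {E ι V : Type*} [MeasurableSpace E] [Countable ι] [Nonempty ι]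
    [NormedAddCommGroup V] [InnerProductSpace ℝ V] (ν : Measure E) [IsProbabilityMeasure ν]
    {n : ℕ} {B D G : ℝ} (hG : 0 ≤ G) (θ : ι → V) (hθ : ∀ q, ‖θ q‖ ≤ D) (Ψ : E → V)
    (K : E → ℝ) (hK : Integrable K ν) (hΨ : ∀ z, ‖Ψ z‖ ^ 2 ≤ K z) (g : ι → E → ℝ)
    (hgm : ∀ q, Measurable (g q)) (hgB : ∀ q z, |g q z| ≤ B)
    (hLip : ∀ p q z, |g p z - g q z| ≤ G * |inner ℝ (θ p) (Ψ z) - inner ℝ (θ q) (Ψ z)|) :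
    ∫ z, ⨆ q, ∑ i, ((∫ x, g q x ∂ν) - g q (z i)) ∂(Measure.pi fun _ : Fin n => ν) ≤
      2 * (G * D * √(n * ∫ x, K x ∂ν)) := by
  set μ := Measure.pi fun _ : Fin n => ν
  have hD : 0 ≤ D := (norm_nonneg _).trans (hθ (Classical.arbitrary ι))
  have hK0 : ∀ z, 0 ≤ K z := fun z => (sq_nonneg _).trans (hΨ z)
  have hKi : ∀ i : Fin n, Integrable (fun z : Fin n → E => K (z i)) μ := fun i =>
    (measurePreserving_eval (fun _ : Fin n => ν) i).integrable_comp_of_integrable hK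
  have hsum : Integrable (fun z : Fin n → E => ∑ i, K (z i)) μ :=
    integrable_finsetSum _ fun i _ => hKi i
  have hsumint : ∫ z : Fin n → E, ∑ i, K (z i) ∂μ = n * ∫ x, K x ∂ν := by
    rw [integral_finsetSum _ fun i _ => hKi i]
    have : ∀ i : Fin n, ∫ z : Fin n → E, K (z i) ∂μ = ∫ x, K x ∂ν := fun i => by
      have hm := measurePreserving_eval (fun _ : Fin n => ν) i
      rw [← hm.map_eq, integral_map hm.aemeasurable (by rw [hm.map_eq]; exact hK.1)]
    simp [this]
  obtain ⟨hsi, hsle⟩ := integral_sqrt_le_sqrt_integral μ hsum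
    fun z => Finset.sum_nonneg fun i _ => hK0 _
  have h := two_pow_mul_integral_iSup_le ν (n := n) g hgm hgB
  have h2 : ∫ z, ∑ ε : Fin n → Bool, ⨆ q, ∑ i, boolSign (ε i) * g q (z i) ∂μ ≤
      ∫ z : Fin n → E, 2 ^ n * (G * D * √(∑ i, K (z i))) ∂μ := by
    refine integral_mono (integrable_finsetSum _ fun ε _ => integrable_of_abs_le _
        (.iSup fun q => by fun_prop) fun z => abs_ciSup_le_of_abs_le fun q =>
          abs_sum_boolSign_mul_le (fun i => hgB q _) ε) ((hsi.const_mul _).const_mul _) fun z => ?_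
    refine (sum_iSup_boolSign_le_of_inner hG θ hθ (fun i => Ψ (z i)) (fun q i => g q (z i))
      (fun q i => hgB q _) fun p q i => hLip p q _).trans ?_
    -- `Ψ` need not be measurable: only its integrable majorant `K` is integrated.
    have : √(∑ i, ‖Ψ (z i)‖ ^ 2) ≤ √(∑ i, K (z i)) :=
      Real.sqrt_le_sqrt (Finset.sum_le_sum fun i _ => hΨ _)
    gcongr
  rw [integral_const_mul, integral_const_mul] at h2
  rw [hsumint] at hsle
  have h3 : G * D * ∫ z : Fin n → E, √(∑ i, K (z i)) ∂μ ≤ G * D * √(n * ∫ x, K x ∂ν) :=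
    mul_le_mul_of_nonneg_left hsle (by positivity)
  have h4 : (0 : ℝ) < 2 ^ n := by positivity
  refine le_of_mul_le_mul_left ?_ h4
  nlinarith [mul_le_mul_of_nonneg_left h3 h4.le]

/-- McDiarmid's inequality at confidence level `1 - δ`, for differences bounded by `4 B`. -/
theorem exists_measurableSet_le_integral_add {E : Type*} [MeasurableSpace E]
    (ν : Measure E) [IsProbabilityMeasure ν] {B M δ : ℝ} (hδ : δ ∈ Set.Ioo (0 : ℝ) 1) {n : ℕ}
    (hn : 0 < n) (f : (Fin n → E) → ℝ) (hf : Measurable f) (hbd : ∀ x, |f x| ≤ M)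
    (hB0 : 0 ≤ B) (hdiff : ∀ x i y, |f x - f (Function.update x i y)| ≤ 4 * B)
    (hzero : B = 0 → ∀ x, f x = 0) :
    ∃ A : Set (Fin n → E), MeasurableSet A ∧
      ENNReal.ofReal (1 - δ) ≤ (Measure.pi fun _ : Fin n => ν) A ∧
      ∀ z ∈ A, f z ≤ ∫ x, f x ∂(Measure.pi fun _ : Fin n => ν) +
        n * (B * 2 * √2 / √n * √(Real.log (1 / δ))) := by
  set μ := Measure.pi fun _ : Fin n => ν
  set L := Real.log (1 / δ)
  have hL : 0 ≤ L := Real.log_nonneg (by rw [le_div_iff₀ hδ.1]; linarith [hδ.2])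
  have hn' : (0 : ℝ) < n := by exact_mod_cast hn
  set s : ℝ := n * (B * 2 * √2 / √n * √L) with hs
  -- For `B = 0` the exponent is a division by zero, equal to `0`, and the tail bound says nothing;
  -- but then `f` vanishes.
  rcases hB0.eq_or_lt with hB | hB
  · refine ⟨Set.univ, .univ, ?_, fun z _ => ?_⟩
    · rw [measure_univ]
      exact ENNReal.ofReal_le_one.2 (by linarith [hδ.1])
    · have h := hzero hB.symm
      simp [h, hs, ← hB]
  refine ⟨{z | s ≤ f z - ∫ x, f x ∂μ}ᶜ, (measurableSet_le measurable_const
    (hf.sub_const _)).compl, ?_, fun z hz => ?_⟩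
  · have h := measureReal_le_sub_integral_le_of_bounded_differences ν (s := s) f hf hbd hdiff
      (by positivity)
    -- The threshold `s` is tuned so that the tail bound is exactly `δ`.
    have hexp : -s ^ 2 / (2 * (n * ((4 * B) ^ 2 / 4))) = -L := by
      have h1 : s ^ 2 = n * B ^ 2 * 8 * L := by
        rw [hs, mul_pow, mul_pow, div_pow, mul_pow, mul_pow, Real.sq_sqrt hL,
          Real.sq_sqrt hn'.le, Real.sq_sqrt (by norm_num)]
        field_simp
        ring
      rw [h1]
      field_simp
      ring
    rw [hexp, Real.exp_neg, Real.exp_log (by have := hδ.1; positivity), one_div, inv_inv] at h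
    rw [measure_compl (measurableSet_le measurable_const (hf.sub_const _)) (measure_ne_top _ _),
      measure_univ, ENNReal.ofReal_sub _ hδ.1.le, ENNReal.ofReal_one]
    refine tsub_le_tsub_left ?_ _
    rw [← ofReal_measureReal]
    exact ENNReal.ofReal_le_ofReal h
  · simp only [Set.mem_compl_iff, Set.mem_ofPred_eq, not_le] at hz
    linarith

/-- Uniform deviation of a Lipschitz image of a ball of linear functionals, relative to a fixed
element of the family, with high probability. -/
theorem exists_measurableSet_uniform_deviation_le {E ι V : Type*} [MeasurableSpace E]
    [Countable ι] [NormedAddCommGroup V] [InnerProductSpace ℝ V] (ν : Measure E)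
    [IsProbabilityMeasure ν] {n : ℕ} (hn : 0 < n) {B D G δ : ℝ} (hδ : δ ∈ Set.Ioo (0 : ℝ) 1)
    (hG : 0 ≤ G) (θ : ι → V) (hθ : ∀ q, ‖θ q‖ ≤ D) (Ψ : E → V) (K : E → ℝ)
    (hK : Integrable K ν) (hΨ : ∀ z, ‖Ψ z‖ ^ 2 ≤ K z) (g : ι → E → ℝ)
    (hgm : ∀ q, Measurable (g q)) (hgB : ∀ q z, |g q z| ≤ B)
    (hLip : ∀ p q z, |g p z - g q z| ≤ G * |inner ℝ (θ p) (Ψ z) - inner ℝ (θ q) (Ψ z)|) (p : ι) :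
    ∃ A : Set (Fin n → E), MeasurableSet A ∧
      ENNReal.ofReal (1 - δ) ≤ (Measure.pi fun _ : Fin n => ν) A ∧
      ∀ z ∈ A, ∀ q, (∫ x, g q x ∂ν - ∫ x, g p x ∂ν) -
          (1 / (n : ℝ) * ∑ i, g q (z i) - 1 / (n : ℝ) * ∑ i, g p (z i)) ≤
        2 * (G * D * √(∫ x, K x ∂ν) / √n) + B * 2 * √2 / √n * √(Real.log (1 / δ)) := by
  have : Nonempty ι := ⟨p⟩
  obtain ⟨z₀⟩ : Nonempty E := ν.nonempty_of_neZero
  have hB0 : 0 ≤ B := (abs_nonneg _).trans (hgB p z₀)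
  have hn' : (0 : ℝ) < n := by exact_mod_cast hn
  set μ := Measure.pi fun _ : Fin n => ν
  -- Centring at `p` inside the supremum lets one use of McDiarmid treat both deviations; the price
  -- is an oscillation of `4 * B` instead of `2 * B`.
  set h : ι → E → ℝ := fun q x => ((∫ x, g q x ∂ν) - g q x) - ((∫ x, g p x ∂ν) - g p x) with hh
  have hhm : ∀ q, Measurable (h q) := fun q => by
    have := hgm q; have := hgm p; fun_prop
  have hc : ∀ q z, |(∫ x, g q x ∂ν) - g q z| ≤ B + B := fun q z =>
    (abs_sub _ _).trans (add_le_add (abs_integral_le_of_abs_le ν (hgB q)) (hgB q z))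
  have hhb : ∀ q x, |h q x| ≤ (B + B) + (B + B) := fun q x =>
    (abs_sub _ _).trans (add_le_add (hc q x) (hc p x))
  set f : (Fin n → E) → ℝ := fun z => ⨆ q, ∑ i, h q (z i) with hf
  have hsb : ∀ q (z : Fin n → E), |∑ i, h q (z i)| ≤ n * ((B + B) + (B + B)) := fun q z =>
    abs_sum_fin_le fun i => hhb q _
  have hbdd : ∀ z : Fin n → E, BddAbove (Set.range fun q => ∑ i, h q (z i)) := fun z =>
    bddAbove_range_of_abs_le fun q => hsb q z
  have hfm : Measurable f := .iSup fun q => by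
    have := hhm q; fun_prop
  have hfb : ∀ z, |f z| ≤ n * ((B + B) + (B + B)) := fun z =>
    abs_ciSup_le_of_abs_le fun q => hsb q z
  have hone : ∀ (z : Fin n → E) i y, f z ≤ f (Function.update z i y) + 4 * B := by
    intro z i y
    refine ciSup_le fun q => ?_
    have h1 := le_ciSup (hbdd (Function.update z i y)) q
    have h2 : ∑ j, h q (z j) - ∑ j, h q (Function.update z i y j) = h q (z i) - h q y := by
      rw [← Finset.sum_sub_distrib, Finset.sum_eq_single i]
      · simp
      · intro j _ hj; simp [Function.update_of_ne hj]
      · simp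
    have h3 : h q (z i) - h q y ≤ 4 * B := by
      have e1 := abs_le.1 (hgB q (z i)); have e2 := abs_le.1 (hgB q y)
      have e3 := abs_le.1 (hgB p (z i)); have e4 := abs_le.1 (hgB p y)
      simp only [hh]; linarith
    simp only [hf] at h1 ⊢
    linarith
  have hdiff : ∀ z i y, |f z - f (Function.update z i y)| ≤ 4 * B := fun z i y => by
    have h1 := hone z i y
    have h2 := hone (Function.update z i y) i (z i)
    rw [Function.update_idem, Function.update_eq_self] at h2
    exact abs_le.2 ⟨by linarith, by linarith⟩
  obtain ⟨A, hAm, hAμ, hA⟩ := exists_measurableSet_le_integral_add ν hδ hn f hfm hfb hB0 hdiff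
    fun hB z => by simpa [hB] using hfb z
  refine ⟨A, hAm, hAμ, fun z hz q => ?_⟩
  have hcm : ∀ i : Fin n, Integrable (fun z : Fin n → E => (∫ x, g p x ∂ν) - g p (z i)) μ :=
    fun i => integrable_of_abs_le _ (by have := hgm p; fun_prop) fun z => hc p _
  have hmean : ∫ x, f x ∂μ ≤ 2 * (G * D * √(n * ∫ x, K x ∂ν)) := by
    refine le_trans (le_of_eq ?_)
      (integral_iSup_deviation_le ν (n := n) hG θ hθ Ψ K hK hΨ g hgm hgB hLip)
    -- The term subtracted for `p` has mean zero, so centring leaves the expected supremum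
    -- unchanged.
    have h0 : ∫ z : Fin n → E, ∑ i, ((∫ x, g p x ∂ν) - g p (z i)) ∂μ = 0 := by
      rw [integral_finsetSum _ fun i _ => hcm i]
      refine Finset.sum_eq_zero fun i _ => ?_
      rw [integral_sub (integrable_const _) (integrable_of_abs_le _ (by have := hgm p; fun_prop)
        fun z => hgB p _),
        (measurePreserving_eval (fun _ : Fin n => ν) i).integral_comp_of_measurable (hgm p)]
      simp
    rw [← add_zero (∫ x, f x ∂μ), ← h0, ← integral_add (integrable_of_abs_le _ hfm hfb)
      (integrable_finsetSum _ fun i _ => hcm i)]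
    refine integral_congr_ae (.of_forall fun z => ?_)
    simp only [hf]
    rw [ciSup_add (hbdd z)]
    congr 1
    ext q
    rw [← Finset.sum_add_distrib]
    refine Finset.sum_congr rfl fun i _ => ?_
    simp only [hh]; ring
  have h1 : ∑ i, h q (z i) ≤ f z := le_ciSup (hbdd z) q
  have h2 := hA z hz
  have h3 : ∑ i, h q (z i) = n * ((∫ x, g q x ∂ν - ∫ x, g p x ∂ν) -
      (1 / (n : ℝ) * ∑ i, g q (z i) - 1 / (n : ℝ) * ∑ i, g p (z i))) := by
    simp only [hh, Finset.sum_sub_distrib, Finset.sum_const, Finset.card_univ, Fintype.card_fin,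
      nsmul_eq_mul]
    field_simp
    ring
  have h4 : 2 * (G * D * √(n * ∫ x, K x ∂ν)) =
      n * (2 * (G * D * √(∫ x, K x ∂ν) / √n)) := by
    rw [Real.sqrt_mul hn'.le]
    have : (n : ℝ) / √n = √n := Real.div_sqrt
    calc _ = 2 * (G * D * √(∫ x, K x ∂ν)) * (n / √n) := by
            rw [this]; ring
      _ = _ := by ring
  refine le_of_mul_le_mul_left ?_ hn'
  rw [← h3, mul_add, ← h4]
  linarith

/-! ### Both penalties dominate the energy -/

namespace HermiteERM

theorem deg_pos {d : ℕ} {α : Fin d → ℕ} (h : α ≠ 0) : 0 < deg α := by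
  by_contra h0
  apply h
  ext a
  have : deg α = 0 := by omega
  exact (Finset.sum_eq_zero_iff.1 this) a (Finset.mem_univ a)

@[simp] theorem deg_zero {d : ℕ} : deg (0 : Fin d → ℕ) = 0 := by simp [deg]

theorem deg_add_single {d : ℕ} (α : Fin d → ℕ) (a : Fin d) :
    deg (α + Pi.single a 1) = deg α + 1 := by
  simp [deg, Finset.sum_add_distrib]

theorem summable_ne_zero_iff {d : ℕ} {u : (Fin d → ℕ) → ℝ} (h : u 0 = 0) :
    Summable (fun α : {α : Fin d → ℕ // α ≠ 0} => u α.1) ↔ Summable u :=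
  Subtype.val_injective.summable_iff fun α hα => by
    have : α = 0 := by simpa using hα
    rw [this, h]

theorem tsum_ne_zero {d : ℕ} {u : (Fin d → ℕ) → ℝ} (h : u 0 = 0) :
    ∑' α : {α : Fin d → ℕ // α ≠ 0}, u α.1 = ∑' α, u α :=
  Subtype.val_injective.tsum_eq fun α hα => by
    have : α ≠ 0 := fun h0 => hα (by rw [h0, h])
    simpa using this

/-- The space of finite linear combinations is part of the space of infinite expansions. -/
theorem hermiteSpan_subset_hermiteSpace {d : ℕ} (c : ℕ → ℝ) :
    hermiteSpan c ⊆ hermiteSpace (d := d) c := fun f hf => by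
  refine ⟨hf.2, ?_, fun x => ?_⟩
  · rw [summable_ne_zero_iff (u := fun α => (deg α : ℝ) / c (deg α) * f α ^ 2) (by simp)]
    refine summable_of_hasFiniteSupport (hf.1.subset fun α hα => ?_)
    simp only [Function.mem_support, ne_eq, mul_eq_zero, not_or] at hα ⊢
    exact fun h => hα.2 (by simp [h])
  · refine summable_of_hasFiniteSupport (hf.1.subset fun α hα => ?_)
    simp only [Function.mem_support, ne_eq, mul_eq_zero, not_or] at hα ⊢
    exact hα.1

/-- The term `(|α| / c_{|α|}) f̂(α)²` of the energy of `f`. -/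
noncomputable def energyTerm {d : ℕ} (c : ℕ → ℝ) (f : Coeff d) (α : Fin d → ℕ) : ℝ :=
  (deg α : ℝ) / c (deg α) * f α ^ 2

/-- The energy term in the direction `a`, `(αₐ / c_{|α|}) f̂(α)²`. -/
noncomputable def energyTermAt {d : ℕ} (c : ℕ → ℝ) (f : Coeff d) (a : Fin d) (α : Fin d → ℕ) : ℝ :=
  (α a : ℝ) / c (deg α) * f α ^ 2

@[simp] theorem energyTerm_zero {d : ℕ} (c : ℕ → ℝ) (f : Coeff d) : energyTerm c f 0 = 0 := by
  simp [energyTerm]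

@[simp] theorem energyTermAt_zero {d : ℕ} (c : ℕ → ℝ) (f : Coeff d) (a : Fin d) :
    energyTermAt c f a 0 = 0 := by
  simp [energyTermAt]

theorem sum_energyTermAt {d : ℕ} (c : ℕ → ℝ) (f : Coeff d) (α : Fin d → ℕ) :
    ∑ a, energyTermAt c f a α = energyTerm c f α := by
  simp only [energyTermAt, energyTerm]
  rw [← Finset.sum_mul, ← Finset.sum_div, deg, Nat.cast_sum]

theorem energyTermAt_nonneg {d : ℕ} {c : ℕ → ℝ} (hc : ∀ k, 0 < k → 0 ≤ c k) (f : Coeff d)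
    (a : Fin d) (α : Fin d → ℕ) : 0 ≤ energyTermAt c f a α := by
  by_cases h : α = 0
  · simp [h]
  · have := hc _ (deg_pos h)
    unfold energyTermAt
    positivity

theorem energyTerm_nonneg {d : ℕ} {c : ℕ → ℝ} (hc : ∀ k, 0 < k → 0 ≤ c k) (f : Coeff d)
    (α : Fin d → ℕ) : 0 ≤ energyTerm c f α := by
  rw [← sum_energyTermAt]
  exact Finset.sum_nonneg fun a _ => energyTermAt_nonneg hc f a α

theorem summable_energyTerm {d : ℕ} {c : ℕ → ℝ} {f : Coeff d} (hf : f ∈ hermiteSpace c) :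
    Summable (energyTerm c f) :=
  (summable_ne_zero_iff (energyTerm_zero c f)).1 hf.2.1

theorem summable_energyTermAt {d : ℕ} {c : ℕ → ℝ} (hc : ∀ k, 0 < k → 0 ≤ c k) {f : Coeff d}
    (hf : f ∈ hermiteSpace c) (a : Fin d) : Summable (energyTermAt c f a) :=
  .of_nonneg_of_le (energyTermAt_nonneg hc f a) (fun α => by
    rw [← sum_energyTermAt]
    exact Finset.single_le_sum (f := fun a => energyTermAt c f a α)
      (fun a _ => energyTermAt_nonneg hc f a α) (Finset.mem_univ a)) (summable_energyTerm hf)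

theorem sum_tsum_energyTermAt {d : ℕ} {c : ℕ → ℝ} (hc : ∀ k, 0 < k → 0 ≤ c k) {f : Coeff d}
    (hf : f ∈ hermiteSpace c) : ∑ a, ∑' α, energyTermAt c f a α = ∑' α, energyTerm c f α := by
  rw [← Summable.tsum_finsetSum fun a _ => summable_energyTermAt hc hf a]
  simp_rw [sum_energyTermAt]

theorem sqrt_sum_le_sum_sqrt {ι : Type*} (s : Finset ι) {v : ι → ℝ} (hv : ∀ i ∈ s, 0 ≤ v i) :
    √(∑ i ∈ s, v i) ≤ ∑ i ∈ s, √(v i) := by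
  refine Real.sqrt_le_iff.2 ⟨Finset.sum_nonneg fun _ _ => Real.sqrt_nonneg _, ?_⟩
  refine le_trans (le_of_eq ?_)
    (Finset.sum_sq_le_sq_sum_of_nonneg (f := fun i => √(v i)) fun i _ => Real.sqrt_nonneg _)
  exact Finset.sum_congr rfl fun i hi => (Real.sq_sqrt (hv i hi)).symm

theorem sqrt_tsum_energyTerm_le_omegaVar {d : ℕ} {c : ℕ → ℝ} (hc : ∀ k, 0 < k → 0 ≤ c k)
    {f : Coeff d} (hf : f ∈ hermiteSpace c) : √(∑' α, energyTerm c f α) ≤ omegaVar c f := by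
  rw [← sum_tsum_energyTermAt hc hf]
  refine (sqrt_sum_le_sum_sqrt _ fun a _ => tsum_nonneg (energyTermAt_nonneg hc f a)).trans
    (le_of_eq (Finset.sum_congr rfl fun a _ => ?_))
  rw [← tsum_ne_zero (energyTermAt_zero c f a)]
  rfl

/-- The summand of the `(a, b)` entry of the matrix `M_f`. -/
noncomputable def featTerm {d : ℕ} (c : ℕ → ℝ) (f : Coeff d) (a b : Fin d) (α : Fin d → ℕ) : ℝ :=
  1 / c (deg α + 1) * √((α a : ℝ) + 1) * √((α b : ℝ) + 1) *
    f (α + Pi.single a 1) * f (α + Pi.single b 1)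

theorem featTerm_eq {d : ℕ} (c : ℕ → ℝ) (f : Coeff d) (a b : Fin d) (α : Fin d → ℕ) :
    featTerm c f a b α = 1 / c (deg α + 1) * ((√((α a : ℝ) + 1) * f (α + Pi.single a 1)) *
      (√((α b : ℝ) + 1) * f (α + Pi.single b 1))) := by
  simp only [featTerm]; ring

theorem featTerm_comm {d : ℕ} (c : ℕ → ℝ) (f : Coeff d) (a b : Fin d) (α : Fin d → ℕ) :
    featTerm c f a b α = featTerm c f b a α := by
  simp only [featTerm]; ring

/-- Since `αₐ + 1 = (α + eₐ)ₐ` and `|α| + 1 = |α + eₐ|`, the diagonal of `M_f` consists of shifted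
directional energies. -/
theorem featTerm_self {d : ℕ} (c : ℕ → ℝ) (f : Coeff d) (a : Fin d) (α : Fin d → ℕ) :
    featTerm c f a a α = energyTermAt c f a (α + Pi.single a 1) := by
  rw [featTerm_eq, energyTermAt, deg_add_single, mul_mul_mul_comm,
    Real.mul_self_sqrt (by positivity)]
  simp
  ring

theorem injective_add_single {d : ℕ} (a : Fin d) :
    Function.Injective fun α : Fin d → ℕ => α + Pi.single a 1 :=
  fun _ _ h => add_right_cancel h

theorem summable_featTerm_self {d : ℕ} {c : ℕ → ℝ} (hc : ∀ k, 0 < k → 0 ≤ c k) {f : Coeff d}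
    (hf : f ∈ hermiteSpace c) (a : Fin d) : Summable (featTerm c f a a) := by
  rw [funext (featTerm_self c f a)]
  exact (summable_energyTermAt hc hf a).comp_injective (injective_add_single a)

/-- The shift by `eₐ` misses only indices with `αₐ = 0`, whose energy in direction `a` is zero. -/
theorem tsum_featTerm_self {d : ℕ} (c : ℕ → ℝ) (f : Coeff d) (a : Fin d) :
    ∑' α, featTerm c f a a α = ∑' α, energyTermAt c f a α := by
  rw [funext (featTerm_self c f a)]
  refine (injective_add_single a).tsum_eq fun α hα => ?_
  have h : α a ≠ 0 := fun h => hα (by simp [energyTermAt, h])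
  refine ⟨α - Pi.single a 1, ?_⟩
  ext b
  by_cases hb : b = a
  · subst hb
    simp
    omega
  · simp [hb]

theorem summable_featTerm {d : ℕ} {c : ℕ → ℝ} (hc : ∀ k, 0 < k → 0 ≤ c k) {f : Coeff d}
    (hf : f ∈ hermiteSpace c) (a b : Fin d) : Summable (featTerm c f a b) := by
  refine .of_norm_bounded ((summable_featTerm_self hc hf a).add (summable_featTerm_self hc hf b))
    fun α => ?_
  rw [featTerm_eq, featTerm_eq, featTerm_eq, ← mul_add, Real.norm_eq_abs, abs_mul,
    abs_of_nonneg (one_div_nonneg.2 (hc _ (Nat.succ_pos _)))]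
  refine mul_le_mul_of_nonneg_left ?_ (one_div_nonneg.2 (hc _ (Nat.succ_pos _)))
  set x := √((α a : ℝ) + 1) * f (α + Pi.single a 1)
  set y := √((α b : ℝ) + 1) * f (α + Pi.single b 1)
  exact abs_le.2 ⟨by nlinarith [sq_nonneg (x + y), sq_nonneg x, sq_nonneg y],
    by nlinarith [sq_nonneg (x - y), sq_nonneg x, sq_nonneg y]⟩

theorem posSemidef_featMatrix {d : ℕ} {c : ℕ → ℝ} (hc : ∀ k, 0 < k → 0 ≤ c k) {f : Coeff d}
    (hf : f ∈ hermiteSpace c) : (featMatrix c f).PosSemidef := by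
  rw [Matrix.posSemidef_iff_dotProduct_mulVec]
  have hent : ∀ a b, featMatrix c f a b = ∑' α, featTerm c f a b α := fun a b => rfl
  refine ⟨?_, fun x => ?_⟩
  · ext a b
    simp only [Matrix.conjTranspose_apply, star_trivial, hent]
    exact tsum_congr fun α => featTerm_comm c f b a α
  · have h1 : star x ⬝ᵥ (featMatrix c f).mulVec x =
        ∑' α, ∑ a, ∑ b, x a * (featTerm c f a b α * x b) := by
      have hs : ∀ a b, Summable fun α => x a * (featTerm c f a b α * x b) := fun a b =>
        ((summable_featTerm hc hf a b).mul_right _).mul_left _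
      rw [Summable.tsum_finsetSum fun a _ => summable_sum fun b _ => hs a b]
      simp only [dotProduct, Matrix.mulVec, star_trivial, hent]
      refine Finset.sum_congr rfl fun a _ => ?_
      rw [Summable.tsum_finsetSum fun b _ => hs a b, Finset.mul_sum]
      refine Finset.sum_congr rfl fun b _ => ?_
      rw [tsum_mul_left, tsum_mul_right]
    rw [h1]
    refine tsum_nonneg fun α => ?_
    -- Each `α` contributes a rank-one Gram matrix with nonnegative weight.
    have h2 : ∑ a, ∑ b, x a * (featTerm c f a b α * x b) = 1 / c (deg α + 1) *
        (∑ a, x a * (√((α a : ℝ) + 1) * f (α + Pi.single a 1))) ^ 2 := by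
      rw [sq, Finset.sum_mul_sum, Finset.mul_sum]
      refine Finset.sum_congr rfl fun a _ => ?_
      rw [Finset.mul_sum]
      refine Finset.sum_congr rfl fun b _ => ?_
      rw [featTerm_eq]
      ring
    rw [h2]
    exact mul_nonneg (one_div_nonneg.2 (hc _ (Nat.succ_pos _))) (sq_nonneg _)

/-- Both traces are sums over the eigenvalues, so this is subadditivity of the square root. -/
theorem sqrt_trace_le_trace_cfc_sqrt {m : Type*} [Fintype m] [DecidableEq m]
    {M : Matrix m m ℝ} (hM : M.PosSemidef) : √M.trace ≤ (cfc Real.sqrt M).trace := by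
  have h1 : (cfc Real.sqrt M).trace = ∑ i, √(hM.isHermitian.eigenvalues i) := by
    rw [hM.isHermitian.cfc_eq, Matrix.IsHermitian.cfc, Unitary.conjStarAlgAut_apply,
      Matrix.trace_mul_cycle]
    simp [Matrix.trace]
  rw [h1, hM.isHermitian.trace_eq_sum_eigenvalues]
  exact sqrt_sum_le_sum_sqrt _ fun i _ => hM.eigenvalues_nonneg i

theorem sqrt_tsum_energyTerm_le_omegaFeat {d : ℕ} {c : ℕ → ℝ} (hc : ∀ k, 0 < k → 0 ≤ c k)
    {f : Coeff d} (hf : f ∈ hermiteSpace c) : √(∑' α, energyTerm c f α) ≤ omegaFeat c f := by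
  refine le_trans (le_of_eq ?_) (sqrt_trace_le_trace_cfc_sqrt (posSemidef_featMatrix hc hf))
  congr 1
  rw [← sum_tsum_energyTermAt hc hf]
  exact Finset.sum_congr rfl fun a _ => (tsum_featTerm_self c f a).symm

end HermiteERM

/-! ### Evaluation as an inner product in `ℓ²` -/

namespace HermiteERM

/-- The Hilbert space of square-summable families indexed by the multi-indices. -/
abbrev MultiSeq (d : ℕ) : Type := lp (fun _ : Fin d → ℕ => ℝ) 2

theorem isSeparable_multiSeq {d : ℕ} (s : Set (MultiSeq d)) : TopologicalSpace.IsSeparable s := by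
  have h1 : TopologicalSpace.IsSeparable
      (Set.range fun α : Fin d → ℕ => (lp.single 2 α (1 : ℝ) : MultiSeq d)) :=
    (Set.countable_range _).isSeparable
  refine (h1.span (R := ℝ)).closure.mono fun f _ => ?_
  refine mem_closure_of_tendsto (lp.hasSum_single (by simp) f) (.of_forall fun t => ?_)
  refine Submodule.sum_mem _ fun α _ => ?_
  have : (lp.single 2 α (f α) : MultiSeq d) = f α • lp.single 2 α (1 : ℝ) := by
    rw [← lp.single_smul]; simp
  rw [this]
  exact Submodule.smul_mem _ _ (Submodule.subset_span ⟨α, rfl⟩)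

theorem memℓp_two_of_summable_sq {ι : Type*} {u : ι → ℝ} (h : Summable fun i => u i ^ 2) :
    Memℓp u 2 :=
  memℓp_gen (by simpa using h)

theorem lp_norm_sq_eq_tsum {ι : Type*} (u : lp (fun _ : ι => ℝ) 2) : ‖u‖ ^ 2 = ∑' i, u i ^ 2 := by
  have := lp.norm_rpow_eq_tsum (p := 2) (by simp) u
  simpa using this

/-- The coefficients of `f`, rescaled so that the energy of `f` becomes a sum of squares. -/
noncomputable def coeffSeq {d : ℕ} (c : ℕ → ℝ) (f : Coeff d) (α : Fin d → ℕ) : ℝ :=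
  (if α = 0 then 1 else √((deg α : ℝ) / c (deg α))) * f α

/-- The feature vector of `x`, dual to the rescaling of `coeffSeq`. -/
noncomputable def featSeq {d : ℕ} (c : ℕ → ℝ) (x : EuclideanSpace ℝ (Fin d))
    (α : Fin d → ℕ) : ℝ :=
  (if α = 0 then 1 else √(c (deg α) / (deg α : ℝ))) * hermiteMulti α x

/-- The squared norm of the feature vector of `x`. -/
noncomputable def featKernel {d : ℕ} (c : ℕ → ℝ) (x : EuclideanSpace ℝ (Fin d)) : ℝ≥0∞ :=
  ∑' α, ENNReal.ofReal (featSeq c x α ^ 2)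

theorem coeffSeq_sq {d : ℕ} {c : ℕ → ℝ} (hc : ∀ k, 0 < k → 0 ≤ c k) (f : Coeff d)
    (α : Fin d → ℕ) :
    coeffSeq c f α ^ 2 = energyTerm c f α + if α = 0 then f 0 ^ 2 else 0 := by
  by_cases h : α = 0
  · simp [coeffSeq, h]
  · have := hc _ (deg_pos h)
    simp only [coeffSeq, h, if_false, mul_pow, energyTerm, add_zero]
    rw [Real.sq_sqrt (by positivity)]

theorem hasSum_coeffSeq_sq {d : ℕ} {c : ℕ → ℝ} (hc : ∀ k, 0 < k → 0 ≤ c k) {f : Coeff d}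
    (hf : f ∈ hermiteSpace c) :
    HasSum (fun α => coeffSeq c f α ^ 2) ((∑' α, energyTerm c f α) + f 0 ^ 2) := by
  simp_rw [coeffSeq_sq hc f]
  exact (summable_energyTerm hf).hasSum.add (hasSum_ite_eq 0 _)

/-- The rescaled coefficients of `f` as an element of `ℓ²`. -/
noncomputable def coeffVec {d : ℕ} {c : ℕ → ℝ} (hc : ∀ k, 0 < k → 0 ≤ c k) {f : Coeff d}
    (hf : f ∈ hermiteSpace c) : MultiSeq d :=
  ⟨coeffSeq c f, memℓp_two_of_summable_sq (hasSum_coeffSeq_sq hc hf).summable⟩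

theorem norm_coeffVec_sq {d : ℕ} {c : ℕ → ℝ} (hc : ∀ k, 0 < k → 0 ≤ c k) {f : Coeff d}
    (hf : f ∈ hermiteSpace c) :
    ‖coeffVec hc hf‖ ^ 2 = (∑' α, energyTerm c f α) + f 0 ^ 2 := by
  rw [lp_norm_sq_eq_tsum]
  exact (hasSum_coeffSeq_sq hc hf).tsum_eq

/-- With energy `E`, the norm is `√(E + f̂(0)²) ≤ √E + |f̂(0)|`, and either penalty dominates `√E`.
-/
theorem norm_coeffVec_le {d : ℕ} {c : ℕ → ℝ} (hc : ∀ k, 0 < k → 0 ≤ c k) {f : Coeff d}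
    (hf : f ∈ hermiteSpace c) {Om : Coeff d → ℝ} (hOm : Om = normVar c ∨ Om = normFeat c) :
    ‖coeffVec hc hf‖ ≤ Om f := by
  have h0 := Real.sqrt_nonneg (∑' α, energyTerm c f α)
  have h : √(∑' α, energyTerm c f α) + |f 0| ≤ Om f := by
    rcases hOm with rfl | rfl
    · exact add_le_add_left (sqrt_tsum_energyTerm_le_omegaVar hc hf) _
    · exact add_le_add_left (sqrt_tsum_energyTerm_le_omegaFeat hc hf) _
  refine le_trans (abs_le_of_sq_le_sq' ?_ (by positivity)).2 h
  rw [norm_coeffVec_sq, add_sq, Real.sq_sqrt (tsum_nonneg (energyTerm_nonneg hc f)), sq_abs]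
  nlinarith [mul_nonneg h0 (abs_nonneg (f 0))]

theorem summable_featSeq_sq {d : ℕ} {c : ℕ → ℝ} {x : EuclideanSpace ℝ (Fin d)}
    (hx : featKernel c x ≠ ∞) : Summable fun α => featSeq c x α ^ 2 := by
  refine (ENNReal.summable_toReal hx).congr fun α => ?_
  rw [ENNReal.toReal_ofReal (sq_nonneg _)]

/-- The feature vector of `x` as an element of `ℓ²`. -/
noncomputable def featVec {d : ℕ} {c : ℕ → ℝ} {x : EuclideanSpace ℝ (Fin d)}
    (hx : featKernel c x ≠ ∞) : MultiSeq d :=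
  ⟨featSeq c x, memℓp_two_of_summable_sq (summable_featSeq_sq hx)⟩

theorem norm_featVec_sq {d : ℕ} {c : ℕ → ℝ} {x : EuclideanSpace ℝ (Fin d)}
    (hx : featKernel c x ≠ ∞) : ‖featVec hx‖ ^ 2 = (featKernel c x).toReal := by
  rw [lp_norm_sq_eq_tsum, featKernel, ENNReal.tsum_toReal_eq fun _ => ENNReal.ofReal_ne_top]
  exact tsum_congr fun α => (ENNReal.toReal_ofReal (sq_nonneg _)).symm

/-- The two weights are mutually inverse where `c_{|α|} > 0`; elsewhere, for `α ≠ 0`, `f̂(α) = 0`.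
-/
theorem inner_coeffVec_featVec {d : ℕ} {c : ℕ → ℝ} (hc : ∀ k, 0 < k → 0 ≤ c k) {f : Coeff d}
    (hf : f ∈ hermiteSpace c) {x : EuclideanSpace ℝ (Fin d)} (hx : featKernel c x ≠ ∞) :
    inner ℝ (coeffVec hc hf) (featVec hx) = eval f x := by
  rw [lp.inner_eq_tsum, eval]
  refine tsum_congr fun α => ?_
  change featSeq c x α * coeffSeq c f α = _
  by_cases h : α = 0
  · simp [featSeq, coeffSeq, h, mul_comm]
  · simp only [featSeq, coeffSeq, h, if_false]
    by_cases hα : 0 < c (deg α)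
    · have hd : (0 : ℝ) < deg α := by exact_mod_cast deg_pos h
      have : √(c (deg α) / deg α) * √((deg α : ℝ) / c (deg α)) = 1 := by
        rw [← Real.sqrt_mul (by positivity), div_mul_div_cancel₀ hd.ne', div_self hα.ne',
          Real.sqrt_one]
      linear_combination f α * hermiteMulti α x * this
    · simp [hf.1 α h hα]

theorem measurable_hermiteMulti {d : ℕ} (α : Fin d → ℕ) :
    Measurable (hermiteMulti α : EuclideanSpace ℝ (Fin d) → ℝ) := by
  unfold hermiteMulti hermiteOne
  refine Finset.measurable_prod _ fun a _ => ?_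
  refine Measurable.div_const ?_ _
  exact (Polynomial.continuous_aeval _).measurable.comp
    (by fun_prop : Continuous fun x : EuclideanSpace ℝ (Fin d) => x a).measurable

theorem measurable_eval {d : ℕ} (f : Coeff d) : Measurable (eval f) :=
  .tsum fun α => (measurable_hermiteMulti α).const_mul _

theorem measurable_featSeq {d : ℕ} (c : ℕ → ℝ) (α : Fin d → ℕ) :
    Measurable fun x : EuclideanSpace ℝ (Fin d) => featSeq c x α :=
  (measurable_hermiteMulti α).const_mul _

theorem measurable_featKernel {d : ℕ} (c : ℕ → ℝ) : Measurable (featKernel (d := d) c) :=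
  .tsum fun α => ((measurable_featSeq c α).pow_const 2).ennreal_ofReal

theorem lintegral_featSeq_sq {d : ℕ} {c : ℕ → ℝ} (hc : ∀ k, 0 < k → 0 ≤ c k)
    (ν : Measure (EuclideanSpace ℝ (Fin d) × ℝ)) {α : Fin d → ℕ} (h : α ≠ 0) :
    ∫⁻ z, ENNReal.ofReal (featSeq c z.1 α ^ 2) ∂ν =
      ENNReal.ofReal (c (deg α) / (deg α : ℝ)) *
        ∫⁻ z, ENNReal.ofReal (hermiteMulti α z.1 ^ 2) ∂ν := by
  have hcd := hc _ (deg_pos h)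
  have hm : Measurable fun z : EuclideanSpace ℝ (Fin d) × ℝ =>
      ENNReal.ofReal (hermiteMulti α z.1 ^ 2) :=
    (((measurable_hermiteMulti α).comp measurable_fst).pow_const 2).ennreal_ofReal
  rw [← lintegral_const_mul _ hm]
  refine lintegral_congr fun z => ?_
  rw [← ENNReal.ofReal_mul (by positivity)]
  simp only [featSeq, h, if_false, mul_pow]
  rw [Real.sq_sqrt (by positivity)]

theorem lintegral_featKernel {d : ℕ} {c : ℕ → ℝ} (hc : ∀ k, 0 < k → 0 ≤ c k)
    (ν : Measure (EuclideanSpace ℝ (Fin d) × ℝ)) [IsProbabilityMeasure ν] :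
    ∫⁻ z, featKernel c z.1 ∂ν = 1 + hermiteMoment c ν := by
  unfold featKernel
  rw [lintegral_tsum (f := fun α (z : EuclideanSpace ℝ (Fin d) × ℝ) =>
    ENNReal.ofReal (featSeq c z.1 α ^ 2)) fun α => (((measurable_featSeq c α).comp
      measurable_fst).pow_const 2).ennreal_ofReal.aemeasurable]
  rw [← Summable.tsum_add_tsum_compl (s := {(0 : Fin d → ℕ)}) ENNReal.summable ENNReal.summable]
  congr 1
  · refine (tsum_singleton (0 : Fin d → ℕ) fun α =>
      ∫⁻ z, ENNReal.ofReal (featSeq c z.1 α ^ 2) ∂ν).trans ?_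
    simp [featSeq, hermiteMulti, hermiteOne]
  · exact tsum_congr fun α : {α : Fin d → ℕ // α ≠ 0} => lintegral_featSeq_sq hc ν α.2

end HermiteERM

/-! ### From countable to separable families, and to i.i.d. samples -/

/-- Uniform deviation of a Lipschitz image of a separable family of linear functionals, relative
to a fixed element of the family, with high probability. -/
theorem exists_measurableSet_uniform_deviation_le_of_isSeparable {E ι V : Type*}
    [MeasurableSpace E] [NormedAddCommGroup V] [InnerProductSpace ℝ V] (ν : Measure E)
    [IsProbabilityMeasure ν] {n : ℕ} (hn : 0 < n) {B D G δ : ℝ} (hδ : δ ∈ Set.Ioo (0 : ℝ) 1)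
    (hG : 0 ≤ G) (θ : ι → V) (hsep : TopologicalSpace.IsSeparable (Set.range θ))
    (hθ : ∀ q, ‖θ q‖ ≤ D) (Ψ : E → V) (K : E → ℝ)
    (hK : Integrable K ν) (hΨ : ∀ z, ‖Ψ z‖ ^ 2 ≤ K z) (g : ι → E → ℝ)
    (hgm : ∀ q, Measurable (g q)) (hgB : ∀ q z, |g q z| ≤ B)
    (hLip : ∀ p q z, |g p z - g q z| ≤ G * |inner ℝ (θ p) (Ψ z) - inner ℝ (θ q) (Ψ z)|) (p : ι) :
    ∃ A : Set (Fin n → E), MeasurableSet A ∧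
      ENNReal.ofReal (1 - δ) ≤ (Measure.pi fun _ : Fin n => ν) A ∧
      ∀ z ∈ A, ∀ q, (∫ x, g q x ∂ν - ∫ x, g p x ∂ν) -
          (1 / (n : ℝ) * ∑ i, g q (z i) - 1 / (n : ℝ) * ∑ i, g p (z i)) ≤
        2 * (G * D * √(∫ x, K x ∂ν) / √n) + B * 2 * √2 / √n * √(Real.log (1 / δ)) := by
  obtain ⟨t, htsub, htc, htd⟩ := hsep.exists_countable_dense_subset
  have : Countable t := htc.to_subtype
  choose r hr using fun v : t => htsub v.2
  -- The extra index `none` keeps the reference `p` itself, so only `q` needs approximating.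
  let r' : Option t → ι := fun o => o.elim p r
  obtain ⟨A, hAm, hAμ, hA⟩ := exists_measurableSet_uniform_deviation_le ν hn hδ hG
    (fun o => θ (r' o)) (fun o => hθ _) Ψ K hK hΨ (fun o => g (r' o)) (fun o => hgm _)
    (fun o => hgB _) (fun o o' => hLip _ _) none
  refine ⟨A, hAm, hAμ, fun z hz q => ?_⟩
  have hK0 : ∀ x, 0 ≤ K x := fun x => (sq_nonneg _).trans (hΨ x)
  have hdiff : ∀ q q' x, |g q x - g q' x| ≤ G * ‖θ q - θ q'‖ * √(K x) := fun q q' x => by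
    refine (hLip q q' x).trans ?_
    rw [← inner_sub_left, mul_assoc]
    refine mul_le_mul_of_nonneg_left ((abs_real_inner_le_norm _ _).trans ?_) hG
    exact mul_le_mul_of_nonneg_left (Real.le_sqrt_of_sq_le (hΨ x)) (norm_nonneg _)
  have hgi : ∀ q, Integrable (g q) ν := fun q => integrable_of_abs_le ν (hgm q) (hgB q)
  have hKi := (integral_sqrt_le_sqrt_integral ν hK hK0).1
  set C : ℝ := G * (∫ x, √(K x) ∂ν + 1 / (n : ℝ) * ∑ i, √(K (z i))) with hC
  have hC0 : 0 ≤ C := mul_nonneg hG (add_nonneg (integral_nonneg fun x => Real.sqrt_nonneg _)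
    (mul_nonneg (by positivity) (Finset.sum_nonneg fun i _ => Real.sqrt_nonneg _)))
  -- For the fixed sample `z`, the deviation is Lipschitz in `θ` with finite constant `C`, so a
  -- dense subfamily suffices.
  have hstep : ∀ q q', (∫ x, g q x ∂ν) - 1 / (n : ℝ) * ∑ i, g q (z i) ≤
      (∫ x, g q' x ∂ν) - 1 / (n : ℝ) * ∑ i, g q' (z i) + C * ‖θ q - θ q'‖ := fun q q' => by
    have h1 : (∫ x, g q x ∂ν) - ∫ x, g q' x ∂ν ≤ G * ‖θ q - θ q'‖ * ∫ x, √(K x) ∂ν := by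
      rw [← integral_sub (hgi q) (hgi q'), ← integral_const_mul]
      exact integral_mono ((hgi q).sub (hgi q')) (hKi.const_mul _)
        fun x => (le_abs_self _).trans (hdiff q q' x)
    have h2 : 1 / (n : ℝ) * (∑ i, g q' (z i) - ∑ i, g q (z i)) ≤
        1 / (n : ℝ) * (G * ‖θ q - θ q'‖ * ∑ i, √(K (z i))) := by
      refine mul_le_mul_of_nonneg_left ?_ (by positivity)
      rw [← Finset.sum_sub_distrib, Finset.mul_sum]
      refine Finset.sum_le_sum fun i _ => ?_
      have := (abs_le.1 (hdiff q q' (z i))).1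
      linarith
    rw [hC]
    linarith
  refine le_of_forall_pos_le_add fun ε hε => ?_
  obtain ⟨v, hvt, hv⟩ := Metric.mem_closure_iff.1 (htd ⟨q, rfl⟩) (ε / (C + 1)) (by positivity)
  have h1 := hA z hz (some ⟨v, hvt⟩)
  have h2 := hstep q (r ⟨v, hvt⟩)
  rw [hr, ← dist_eq_norm] at h2
  have h3 : C * dist (θ q) v ≤ ε := by
    have := (lt_div_iff₀ (by positivity : 0 < C + 1)).1 hv
    nlinarith [dist_nonneg (x := θ q) (y := v)]
  simp only [r', Option.elim] at h1
  linarith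

/-- An event about an i.i.d. sample has the probability given by the product measure. -/
theorem exists_measurableSet_of_iIndepFun {E S : Type*} [MeasurableSpace E] [MeasurableSpace S]
    {ν : Measure E} {P : Measure S} [IsProbabilityMeasure P] {n : ℕ} {Z : Fin n → S → E}
    (hlaw : ∀ i, HasLaw (Z i) ν P) (hind : iIndepFun Z P) {A : Set (Fin n → E)}
    (hA : MeasurableSet A) :
    ∃ A' : Set S, MeasurableSet A' ∧ P A' = (Measure.pi fun _ : Fin n => ν) A ∧
      ∀ ω ∈ A', (fun i => Z i ω) ∈ A := by
  have hm : AEMeasurable (fun ω i => Z i ω) P :=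
    aemeasurable_pi_lambda _ fun i => (hlaw i).aemeasurable
  have hmap : P.map (fun ω i => Z i ω) = Measure.pi fun _ : Fin n => ν := by
    rw [(iIndepFun_iff_map_fun_eq_pi_map fun i => (hlaw i).aemeasurable).1 hind]
    simp_rw [fun i => (hlaw i).map_eq]
  -- The sample map is only a.e. measurable, so the preimage of `A` is shrunk to a measurable set of
  -- equal measure.
  obtain ⟨A', hsub, hA'm, hA'⟩ := (hm.nullMeasurable hA).exists_measurable_subset_ae_eq
  refine ⟨A', hA'm, ?_, fun ω hω => hsub hω⟩
  rw [measure_congr hA', ← hmap, Measure.map_apply_of_aemeasurable hm hA]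

/-! ### Risk bound for Hermite expansions -/

namespace HermiteERM

theorem eq_zero_of_norm_coeffVec_le_zero {d : ℕ} {c : ℕ → ℝ} (hc : ∀ k, 0 < k → 0 ≤ c k)
    {f : Coeff d} (hf : f ∈ hermiteSpace c) (h : ‖coeffVec hc hf‖ ≤ 0) : f = 0 := by
  have h0 : coeffVec hc hf = 0 := norm_le_zero_iff.1 h
  ext α
  have hα : coeffSeq c f α = 0 := congrArg (fun v : MultiSeq d => v α) h0
  by_cases h1 : α = 0
  · simpa [coeffSeq, h1] using hα
  by_cases h2 : 0 < c (deg α)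
  · have hd : (0 : ℝ) < deg α := by exact_mod_cast deg_pos h1
    simp only [coeffSeq, h1, if_false, mul_eq_zero] at hα
    exact hα.resolve_left (by positivity)
  · exact hf.1 α h1 h2

section

variable {d n : ℕ} {c : ℕ → ℝ} {F : Set (Coeff d)} {Om : Coeff d → ℝ} {ℓ : ℝ → ℝ → ℝ}
  {ν : Measure (EuclideanSpace ℝ (Fin d) × ℝ)} {𝒳 : Set (EuclideanSpace ℝ (Fin d))}
  {𝒴 : Set ℝ} {D G : ℝ}

/-- If the ball or the Lipschitz constant is trivial, all functions of the ball have the same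
risk. -/
theorem risk_eq_of_mul_eq_zero (hc : ∀ k, 0 < k → 0 ≤ c k) (hF : F ⊆ hermiteSpace c)
    (hOm : Om = normVar c ∨ Om = normFeat c) (hν : ∀ᵐ z ∂ν, z.1 ∈ 𝒳 ∧ z.2 ∈ 𝒴)
    (hLip : ∀ y ∈ 𝒴, ∀ x ∈ 𝒳, ∀ x' ∈ 𝒳, ∀ f ∈ F, ∀ g ∈ F, Om f ≤ D → Om g ≤ D →
      |ℓ y (eval f x) - ℓ y (eval g x')| ≤ G * |eval f x - eval g x'|)
    (hGD : G * D = 0) {f g : Coeff d} (hf : f ∈ F) (hfD : Om f ≤ D) (hg : g ∈ F)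
    (hgD : Om g ≤ D) : risk ℓ ν f = risk ℓ ν g := by
  rcases mul_eq_zero.1 hGD with h | h
  · refine integral_congr_ae ?_
    filter_upwards [hν] with z hz
    have := hLip z.2 hz.2 z.1 hz.1 z.1 hz.1 f hf g hg hfD hgD
    rw [h, zero_mul] at this
    exact sub_eq_zero.1 (abs_nonpos_iff.1 this)
  · rw [eq_zero_of_norm_coeffVec_le_zero hc (hF hf)
        ((norm_coeffVec_le hc (hF hf) hOm).trans (hfD.trans h.le)),
      eq_zero_of_norm_coeffVec_le_zero hc (hF hg)
        ((norm_coeffVec_le hc (hF hg) hOm).trans (hgD.trans h.le))]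

/-- The generalization bound over product samples when the Hermite moment is finite. -/
theorem exists_measurableSet_risk_le [IsProbabilityMeasure ν] (hn : 0 < n)
    (hc : ∀ k, 0 < k → 0 ≤ c k) (hF : F ⊆ hermiteSpace c)
    (hOm : Om = normVar c ∨ Om = normFeat c) (hℓ : Measurable (Function.uncurry ℓ))
    (hν : ∀ᵐ z ∂ν, z.1 ∈ 𝒳 ∧ z.2 ∈ 𝒴) {fstar : Coeff d} (hfstar : fstar ∈ F)
    (hD : Om fstar ≤ D) (hG : 0 ≤ G)
    (hLip : ∀ y ∈ 𝒴, ∀ x ∈ 𝒳, ∀ x' ∈ 𝒳, ∀ f ∈ F, ∀ g ∈ F, Om f ≤ D → Om g ≤ D →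
      |ℓ y (eval f x) - ℓ y (eval g x')| ≤ G * |eval f x - eval g x'|)
    (hbdd : BddAbove (lossValues ℓ 𝒳 𝒴 F Om D)) {δ : ℝ} (hδ : δ ∈ Set.Ioo (0 : ℝ) 1)
    (hfin : hermiteMoment c ν ≠ ∞) :
    ∃ A : Set (Fin n → EuclideanSpace ℝ (Fin d) × ℝ), MeasurableSet A ∧
      ENNReal.ofReal (1 - δ) ≤ (Measure.pi fun _ : Fin n => ν) A ∧
      ∀ z ∈ A, ∀ fD : Coeff d, IsConstrainedERM ℓ z F Om D fD →
        risk ℓ ν fD ≤ risk ℓ ν fstar +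
          (2 * (G * D * √(1 + hermiteMoment c ν).toReal / √n) +
            sSup (lossValues ℓ 𝒳 𝒴 F Om D) * 2 * √2 / √n * √(Real.log (1 / δ))) := by
  set B := sSup (lossValues ℓ 𝒳 𝒴 F Om D)
  have hB : 0 ≤ B := Real.sSup_nonneg (by rintro _ ⟨_, _, _, _, _, _, _, rfl⟩; exact abs_nonneg _)
  have hkm : Measurable fun z : EuclideanSpace ℝ (Fin d) × ℝ => featKernel c z.1 :=
    (measurable_featKernel c).comp measurable_fst
  have hkfin : ∫⁻ z, featKernel c z.1 ∂ν ≠ ∞ := by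
    rw [lintegral_featKernel hc]
    exact ENNReal.add_ne_top.2 ⟨ENNReal.one_ne_top, hfin⟩
  have hklt : ∀ᵐ z ∂ν, featKernel c z.1 < ∞ := ae_lt_top hkm hkfin
  -- Off this full-measure set `g` and `Ψ` are set to zero, so the bounds hold everywhere, as the
  -- deviation theorem requires.
  obtain ⟨s, hsν, hsm, hs⟩ := (hν.and hklt).exists_measurable_mem
  have hKint : Integrable (fun z : EuclideanSpace ℝ (Fin d) × ℝ => (featKernel c z.1).toReal) ν :=
    integrable_toReal_of_lintegral_ne_top hkm.aemeasurable hkfin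
  have hKval : ∫ z, (featKernel c z.1).toReal ∂ν = (1 + hermiteMoment c ν).toReal := by
    rw [integral_toReal hkm.aemeasurable hklt, lintegral_featKernel hc]
  let Ball := {f : Coeff d // f ∈ F ∧ Om f ≤ D}
  let θ : Ball → MultiSeq d := fun f => coeffVec hc (hF f.2.1)
  classical
  let Ψ : EuclideanSpace ℝ (Fin d) × ℝ → MultiSeq d :=
    fun z => if h : z ∈ s then featVec (hs z h).2.ne else 0
  let g : Ball → EuclideanSpace ℝ (Fin d) × ℝ → ℝ :=
    fun f => s.indicator fun z => ℓ z.2 (eval f.1 z.1)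
  have hΨ : ∀ z, ‖Ψ z‖ ^ 2 ≤ (featKernel c z.1).toReal := fun z => by
    by_cases h : z ∈ s
    · simp only [Ψ, h, dif_pos]
      exact (norm_featVec_sq _).le
    · simp [Ψ, h]
  have hgm : ∀ f, Measurable (g f) := fun f => Measurable.indicator
    (hℓ.comp (measurable_snd.prodMk ((measurable_eval f.1).comp measurable_fst))) hsm
  have hgB : ∀ f z, |g f z| ≤ B := fun f z => by
    by_cases h : z ∈ s
    · simp only [g, Set.indicator_of_mem h]
      exact le_csSup hbdd ⟨z.1, (hs z h).1.1, z.2, (hs z h).1.2, f.1, f.2.1, f.2.2, rfl⟩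
    · simpa [g, h] using hB
  have hgL : ∀ p q z, |g p z - g q z| ≤
      G * |inner ℝ (θ p) (Ψ z) - inner ℝ (θ q) (Ψ z)| := fun p q z => by
    by_cases h : z ∈ s
    · simp only [g, Set.indicator_of_mem h, Ψ, h, dif_pos, θ, inner_coeffVec_featVec]
      exact hLip z.2 (hs z h).1.2 z.1 (hs z h).1.1 z.1 (hs z h).1.1 p.1 p.2.1 q.1 q.2.1
        p.2.2 q.2.2
    · simp [g, Ψ, h]
  obtain ⟨A, hAm, hAμ, hA⟩ := exists_measurableSet_uniform_deviation_le_of_isSeparable ν hn hδ hG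
    θ (isSeparable_multiSeq _) (fun f => (norm_coeffVec_le hc _ hOm).trans f.2.2) Ψ _ hKint hΨ g
    hgm hgB hgL ⟨fstar, hfstar, hD⟩
  have hall : ∀ᵐ z ∂(Measure.pi fun _ : Fin n => ν), z ∈ Set.univ.pi fun _ : Fin n => s := by
    have : ∀ᵐ z ∂(Measure.pi fun _ : Fin n => ν), ∀ i, z i ∈ s := ae_all_iff.2 fun i =>
      (measurePreserving_eval (fun _ : Fin n => ν) i).quasiMeasurePreserving.ae hsν
    filter_upwards [this] with z hz i _ using hz i
  refine ⟨A ∩ Set.univ.pi fun _ => s, hAm.inter (.univ_pi fun _ => hsm), ?_, ?_⟩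
  · rwa [measure_inter_conull (t := Set.univ.pi fun _ : Fin n => s) hall]
  · rintro z ⟨hzA, hzs⟩ fD ⟨hfF, hfD, hmin⟩
    have hrisk : ∀ f : Ball, ∫ x, g f x ∂ν = risk ℓ ν f.1 := fun f => integral_congr_ae <| by
      filter_upwards [hsν] with x hx
      exact Set.indicator_of_mem hx _
    have hemp : ∀ f : Ball, 1 / (n : ℝ) * ∑ i, g f (z i) = empRisk ℓ z f.1 := fun f => by
      simp only [empRisk, g]
      congr 1
      exact Finset.sum_congr rfl fun i _ => Set.indicator_of_mem (hzs i trivial) _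
    have h := hA z hzA ⟨fD, hfF, hfD⟩
    rw [hrisk, hrisk, hemp, hemp, hKval] at h
    -- The empirical risk difference is nonpositive, so the relative deviation bounds the excess
    -- risk.
    have := hmin fstar hfstar hD
    simp only at h
    linarith

end

end HermiteERM

theorem lemmaA1 {d n : ℕ} (hn : 0 < n)
    -- the weights and the function space, finite span or infinite expansions
    (c : ℕ → ℝ) (hc : ∀ k, 0 < k → 0 ≤ c k)
    (F : Set (Coeff d)) (hF : F = hermiteSpan c ∨ F = hermiteSpace c)
    -- the norm, for either of the two penalties
    (Om : Coeff d → ℝ) (hOm : Om = normVar c ∨ Om = normFeat c)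
    -- the loss
    (ℓ : ℝ → ℝ → ℝ) (hℓ : Measurable (Function.uncurry ℓ))
    -- the law of the pair of random variables, carried by the product of the two sets
    (ν : Measure (EuclideanSpace ℝ (Fin d) × ℝ)) [IsProbabilityMeasure ν]
    (𝒳 : Set (EuclideanSpace ℝ (Fin d))) (𝒴 : Set ℝ)
    (hν : ∀ᵐ z ∂ν, z.1 ∈ 𝒳 ∧ z.2 ∈ 𝒴)
    -- the i.i.d. data
    {S : Type*} [MeasurableSpace S] (P : Measure S) [IsProbabilityMeasure P]
    (Z : Fin n → S → EuclideanSpace ℝ (Fin d) × ℝ)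
    (hlaw : ∀ i, HasLaw (Z i) ν P) (hind : iIndepFun Z P)
    -- the minimiser of the expected risk
    (fstar : Coeff d) (hfstar : IsRiskMinimiser ℓ ν F fstar)
    (D : ℝ) (hD : Om fstar ≤ D)
    -- the loss is Lipschitz in its second argument on the values of the functions of the ball
    (G : ℝ) (hG : 0 ≤ G)
    (hLip : ∀ y ∈ 𝒴, ∀ x ∈ 𝒳, ∀ x' ∈ 𝒳, ∀ f ∈ F, ∀ g ∈ F, Om f ≤ D → Om g ≤ D →
      |ℓ y (eval f x) - ℓ y (eval g x')| ≤ G * |eval f x - eval g x'|)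
    -- the loss is bounded on the ball
    (hbdd : BddAbove (lossValues ℓ 𝒳 𝒴 F Om D))
    (δ : ℝ) (hδ : δ ∈ Set.Ioo (0 : ℝ) 1) :
    ∃ A : Set S, MeasurableSet A ∧ ENNReal.ofReal (1 - δ) ≤ P A ∧
      ∀ ω ∈ A, ∀ fD : Coeff d, IsConstrainedERM ℓ (fun i => Z i ω) F Om D fD →
        (risk ℓ ν fD : EReal) ≤
          (risk ℓ ν fstar : EReal) +
            ((4 * G * D / √(n : ℝ) * √(Real.pi / 2) : ℝ) : EReal) *
              (((1 + hermiteMoment c ν) ^ (1 / 2 : ℝ) : ℝ≥0∞) : EReal) +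
            ((sSup (lossValues ℓ 𝒳 𝒴 F Om D) * 2 * √2 / √(n : ℝ) *
              √(Real.log (1 / δ)) : ℝ) : EReal) := by
  have hFs : F ⊆ hermiteSpace c := by
    rcases hF with rfl | rfl
    · exact hermiteSpan_subset_hermiteSpace c
    · exact subset_rfl
  obtain ⟨hstar, -, -⟩ := hfstar
  have hD0 : 0 ≤ D := ((norm_nonneg _).trans (norm_coeffVec_le hc (hFs hstar) hOm)).trans hD
  have hB : 0 ≤ sSup (lossValues ℓ 𝒳 𝒴 F Om D) :=
    Real.sSup_nonneg (by rintro _ ⟨_, _, _, _, _, _, _, rfl⟩; exact abs_nonneg _)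
  have hn' : (0 : ℝ) < n := by exact_mod_cast hn
  have hGD : 0 ≤ G * D := mul_nonneg hG hD0
  have huniv : ENNReal.ofReal (1 - δ) ≤ P Set.univ := by
    rw [measure_univ]
    exact ENNReal.ofReal_le_one.2 (by linarith [hδ.1])
  set T : ℝ := sSup (lossValues ℓ 𝒳 𝒴 F Om D) * 2 * √2 / √(n : ℝ) * √(Real.log (1 / δ)) with hT
  have hT0 : 0 ≤ T := by positivity
  have hcoef : 4 * G * D / √(n : ℝ) * √(Real.pi / 2) =
      G * D * (4 / √(n : ℝ) * √(Real.pi / 2)) := by ring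
  have hpi : 1 ≤ √(Real.pi / 2) := Real.one_le_sqrt.2 (by linarith [Real.two_le_pi])
  have hpos : 0 < 4 / √(n : ℝ) * √(Real.pi / 2) := by positivity
  -- If `GD = 0` the middle term is zero even for an infinite moment (`0 · ∞ = 0`), so this case
  -- needs equality of the risks.
  rcases hGD.eq_or_lt with h0 | h0
  · refine ⟨Set.univ, .univ, huniv, fun ω _ fD hfD => ?_⟩
    rw [risk_eq_of_mul_eq_zero hc hFs hOm hν hLip h0.symm hfD.1 hfD.2.1 hstar hD, hcoef, ← h0]
    simp only [zero_mul, EReal.coe_zero, add_zero]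
    exact_mod_cast le_add_of_nonneg_right hT0
  by_cases hfin : hermiteMoment c ν = ∞
  · refine ⟨Set.univ, .univ, huniv, fun ω _ fD _ => ?_⟩
    rw [hfin, add_top, ENNReal.top_rpow_of_pos (by norm_num), EReal.coe_ennreal_top,
      EReal.coe_mul_top_of_pos (by rw [hcoef]; positivity), EReal.coe_add_top, EReal.top_add_coe]
    exact le_top
  obtain ⟨A, hAm, hAν, hA⟩ := exists_measurableSet_risk_le hn hc hFs hOm hℓ hν hstar hD hG hLip
    hbdd hδ hfin
  obtain ⟨A', hAm', hAP, hsub⟩ := exists_measurableSet_of_iIndepFun hlaw hind hAm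
  refine ⟨A', hAm', hAP ▸ hAν, fun ω hω fD hfD => ?_⟩
  have h := hA _ (hsub ω hω) fD hfD
  set m := 1 + hermiteMoment c ν
  have hm : m ≠ ∞ := ENNReal.add_ne_top.2 ⟨ENNReal.one_ne_top, hfin⟩
  have hrpow : m ^ (1 / 2 : ℝ) = ENNReal.ofReal √m.toReal := by
    rw [Real.sqrt_eq_rpow, ENNReal.toReal_rpow, ENNReal.ofReal_toReal]
    exact ENNReal.rpow_ne_top_of_nonneg (by norm_num) hm
  rw [hrpow, EReal.coe_ennreal_ofReal, max_eq_left (Real.sqrt_nonneg _)]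
  -- The Rademacher argument yields the constant `2`, which is at most `4√(π/2)`.
  have hle : 2 * (G * D * √m.toReal / √n) ≤
      4 * G * D / √(n : ℝ) * √(Real.pi / 2) * √m.toReal := by
    calc 2 * (G * D * √m.toReal / √n) = G * D * √m.toReal / √n * 2 := by ring
      _ ≤ G * D * √m.toReal / √n * (4 * √(Real.pi / 2)) :=
        mul_le_mul_of_nonneg_left (by linarith) (by positivity)
      _ = _ := by ring
  have hfinal : risk ℓ ν fD ≤ risk ℓ ν fstar +
      4 * G * D / √(n : ℝ) * √(Real.pi / 2) * √m.toReal + T := by linarith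
  exact_mod_cast hfinal
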